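/- Let $n$ and $k$ be integers with $2\le k\le n-1$. Let $\mathscr T_n^k$ be the set of all trees with $n$ vertices and exactly $k$ leaves (vertices of degree $1$), up to isomorphism. A subtree of a tree is a non-empty connected induced subgraph. Let $T_n^k$ be the $n$-vertex spider consisting of $k$ paths (legs) of positive lengths $l_1,\dots,l_k$ with $l_1+\dots+l_k=n-1$ that share one end vertex (the center) and are otherwise disjoint, where $|l_i-l_j|\le 1$ for all $i,j$. For $m\ge1$, let $P_m(a,b)$ be the tree obtained from the path $P_m$ on $m$ vertices by attaching $a$ pendant vertices to one end vertex and $b$ pendant vertices to the other (so $P_1(a,b)=K_{1,a+b}$). Both $T_n^k$ and $P_{n-k}(\lfloor k/2\rfloor,\lceil k/2\rceil)$ belong to $\mathscr T_n^k$, and the following hold. (i) Among the trees in $\mathscr T_n^k$, the number of subtrees is maximized precisely by $T_n^k$, which has $$\left(\left\lfloor\tfrac{n-1}{k}\right\rfloor+1\right)^i\left(\left\lceil\tfrac{n-1}{k}\right\rceil+1\right)^j+i\binom{\lfloor\frac{n-1}{k}\rfloor+1}{2}+j\binom{\lceil\frac{n-1}{k}\rceil+1}{2}$$ subtrees, where $i,j\ge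 0$ are any integers with $i+j=k$ and $n-1\equiv j\pmod k$. (ii) Among the trees in $\mathscr T_n^k$, the number of subtrees is minimized precisely by $P_{n-k}(\lfloor k/2\rfloor,\lceil k/2\rceil)$, which has $$\left(2^{\lfloor k/2\rfloor}+2^{\lceil k/2\rceil}\right)(n-k-1)+2^k+k+\binom{n-k-1}{2}$$ subtrees. -/

import Mathlib

open Finset

namespace Subtrees

/-- The leaves (pendant vertices) of a finite graph: the vertices of degree `1`. -/
noncomputable def leaves {V : Type*} [Fintype V] (G : SimpleGraph V) : Finset V :=
  open scoped Classical in {v | G.degree v = 1}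

/-- `G` is (on its own vertex type) an `n`-vertex tree with exactly `k` leaves. -/
structure IsTreeWithLeaves {V : Type*} [Fintype V] (n k : ℕ) (G : SimpleGraph V) : Prop where
  isTree : G.IsTree
  card_vertices : Fintype.card V = n
  card_leaves : #(leaves G) = k

/-- The number of subtrees of a tree, that is, of its connected induced subgraphs. An induced
subgraph is determined by its vertex set, and `Connected` includes that it is non-empty. -/
noncomputable def numSubtrees {V : Type*} (G : SimpleGraph V) : ℕ :=
  {s : Set V | (G.induce s).Connected}.ncard

/-- The vertices of a spider with leg lengths `l`: the center `none`, and on the `i`-th leg the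
vertices `some ⟨i, 0⟩, …, some ⟨i, l i - 1⟩`, in order of their distance from the center. -/
abbrev SpiderVertex {k : ℕ} (l : Fin k → ℕ) : Type := Option (Σ i : Fin k, Fin (l i))

/-- The edges of a spider, each oriented away from the center. -/
def spiderEdge {k : ℕ} (l : Fin k → ℕ) : SpiderVertex l → SpiderVertex l → Prop
  | none, some y => y.2.val = 0
  | some x, some y => x.1 = y.1 ∧ x.2.val + 1 = y.2.val
  | _, none => False

/-- The spider whose `k` legs are paths with `l i` edges starting at the common center. -/
def spider {k : ℕ} (l : Fin k → ℕ) : SimpleGraph (SpiderVertex l) :=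
  SimpleGraph.fromRel (spiderEdge l)

/-- `l` is a list of lengths of `k` legs (each of length at least one) of a spider on `n` vertices,
any two lengths differing by at most one. The graph `T_n^k` is `spider l` for such an `l`. -/
structure IsBalancedLegs (n : ℕ) {k : ℕ} (l : Fin k → ℕ) : Prop where
  pos : ∀ i, 1 ≤ l i
  card_eq : 1 + ∑ i, l i = n
  almost_equal : ∀ i j, l i ≤ l j + 1

/-- The edges of `P_m(a, b)`: those of the path on `Fin m`, from its first vertex to each of the
`a` pendant vertices, and from its last vertex to each of the `b` pendant vertices. -/
def broomEdge (m a b : ℕ) : Fin m ⊕ (Fin a ⊕ Fin b) → Fin m ⊕ (Fin a ⊕ Fin b) → Prop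
  | .inl x, .inl y => x.val + 1 = y.val
  | .inl x, .inr (.inl _) => x.val = 0
  | .inl x, .inr (.inr _) => x.val + 1 = m
  | .inr _, _ => False

/-- The graph `P_m(a, b)` obtained from the path `P_m` on `m ≥ 1` vertices by attaching `a` pendant
vertices to one end and `b` to the other; for `m = 1` it is the star `K_{1, a + b}`. -/
def doubleBroom (m a b : ℕ) : SimpleGraph (Fin m ⊕ (Fin a ⊕ Fin b)) :=
  SimpleGraph.fromRel (broomEdge m a b)

end Subtrees

/-!
The trees are studied as induced subgraphs on finite vertex sets `s` of a fixed graph, so that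
vertices can be removed without changing types. Everything is counted by removing pendant vertices:
if `v` is a leaf of the tree `insert v s` hanging from `u`, then a connected set through `v` is
either `{v}` or a connected set of `s` through `u`, extended by `v`
(`Pendant.connected_insert_iff`). The counts are allowed to carry multiplicative vertex weights
(`wcount`).

**Maximum.** Attaching a leg of length `l` at `c` to a tree `s'` creates `l` subtrees for each
subtree of `s'` through `c`, and `(l + 1).choose 2` subtrees inside the leg (`Leg.wcount_empty`); the
subtrees through a vertex `b` of `s'` increase at most by the factor `l + 1`, with equality only for
`c = b` (`Leg.wcount_of_nonempty`). By the second fact, the number of subtrees through a vertex `b`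
is at most `∏ i, (l i + 1)` for some leg lengths `l`, with equality only for the spider centered at
`b` (`TreeOn.exists_wcount_le`). By the first fact and induction on the number of leaves, the total
is at most that of a spider whose legs are balanced except for one (`TreeOn.wcount_le`). Finally,
balancing the legs of a spider with at least three legs increases its number of subtrees strictly
(`IsBalancedLegs.isMax`). With two leaves, the tree is a path.

**Minimum.** A subtree is a single leaf, or a subtree `S` of the tree `C` of the `n - k` inner
vertices together with some of the leaves adjacent to `S`. Hence the number of subtrees is
`k + ∑ S, 2 ^ w(S)`, where `w` counts the leaves adjacent to a vertex (`TreeOn.wcount_eq_sdiff`).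
Among the sets `S`, there are `C` itself, with `w(C) = k`, and the two sides of each of the
`n - k - 1` edges of `C`, with total weight `2 ^ x + 2 ^ (k - x) ≥ 2 ^ ⌊k/2⌋ + 2 ^ ⌈k/2⌉`; at least
`(n - k - 1).choose 2` others remain. Equality forces `C` to be a path with all leaves at its ends,
evenly distributed. The formal proof of this bound (`TreeOn.le_wcount`) is an induction that removes
a leaf of `C` and moves its weight to its neighbour.
-/

namespace Subtrees

section

open scoped Classical

section

variable {V : Type*} {G : SimpleGraph V}

/-! ### Trees induced on finite vertex sets, and their leaves -/

/-- The subgraph induced on the finite vertex set `S` is connected (in particular, `S ≠ ∅`). -/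
def ConnectedOn (G : SimpleGraph V) (S : Finset V) : Prop := (G.induce (S : Set V)).Connected

lemma connected_singleton (G : SimpleGraph V) (v : V) :
    ConnectedOn G {v} := by
  unfold ConnectedOn
  rw [coe_singleton]
  have : Subsingleton (({v} : Set V)) := ⟨by rintro ⟨a, rfl⟩ ⟨b, rfl⟩; rfl⟩
  have : Nonempty (({v} : Set V)) := ⟨⟨v, rfl⟩⟩
  exact ⟨SimpleGraph.Preconnected.of_subsingleton⟩

lemma not_connected_empty (G : SimpleGraph V) : ¬ ConnectedOn G ∅ := by
  intro h
  obtain ⟨⟨x, hx⟩⟩ := h.nonempty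
  simp at hx

/-- The number of neighbours of `v` in `s`. -/
noncomputable def degIn (G : SimpleGraph V) (s : Finset V) (v : V) : ℕ := #{x ∈ s | G.Adj v x}

/-- The leaves of the subgraph induced on `s`. -/
noncomputable def leavesIn (G : SimpleGraph V) (s : Finset V) : Finset V :=
  {v ∈ s | degIn G s v = 1}

/-- `v` lies outside `s` and `u` is its only neighbour in `s`: on `insert v s`, the vertex `v` is a
leaf hanging from `u`. -/
structure Pendant (G : SimpleGraph V) (s : Finset V) (v u : V) : Prop where
  notMem : v ∉ s
  mem : u ∈ s
  adj_iff : ∀ x ∈ s, G.Adj v x ↔ x = u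

lemma Pendant.adj {s : Finset V} {v u : V} (h : Pendant G s v u) : G.Adj v u :=
  (h.adj_iff u h.mem).2 rfl

lemma Pendant.ne {s : Finset V} {v u : V} (h : Pendant G s v u) : v ≠ u := h.adj.ne

lemma mem_leavesIn {s : Finset V} {v : V} : v ∈ leavesIn G s ↔ v ∈ s ∧ degIn G s v = 1 := by
  simp [leavesIn]

lemma exists_pendant_of_mem_leavesIn {s : Finset V} {v : V} (hv : v ∈ leavesIn G s) :
    ∃ u, Pendant G (s.erase v) v u := by
  obtain ⟨hvs, hd⟩ := mem_leavesIn.1 hv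
  obtain ⟨u, hu⟩ := card_eq_one.1 hd
  have key : ∀ x, x ∈ s ∧ G.Adj v x ↔ x = u := fun x => by
    simpa using congrArg (x ∈ ·) hu
  have hadj := ((key u).2 rfl)
  refine ⟨u, by simp, by simp [hadj.1, hadj.2.ne'], fun x hx => ?_⟩
  rw [← key x]
  simp [mem_of_mem_erase hx]

lemma Pendant.degIn_insert {s : Finset V} {v u : V} (h : Pendant G s v u) :
    degIn G (insert v s) u = degIn G s u + 1 := by
  unfold degIn
  rw [filter_insert, if_pos h.adj.symm, card_insert_of_notMem (by simp [h.notMem])]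

lemma Pendant.degIn_insert_of_ne {s : Finset V} {v u x : V} (h : Pendant G s v u) (hx : x ∈ s)
    (hxu : x ≠ u) : degIn G (insert v s) x = degIn G s x := by
  unfold degIn
  rw [filter_insert, if_neg]
  rw [G.adj_comm, h.adj_iff x hx]
  exact hxu

/-- A connected set cannot reach beyond a pendant vertex: the connected sets containing it are
the singleton and the connected sets through its neighbour, extended by it. -/
lemma Pendant.connected_insert_iff {s S : Finset V} {v u : V} (h : Pendant G s v u) (hS : S ⊆ s) :
    ConnectedOn G (insert v S) ↔
      S = ∅ ∨ (u ∈ S ∧ ConnectedOn G S) := by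
  have hvS : v ∉ S := fun h' => h.notMem (hS h')
  constructor
  · intro hc
    rcases S.eq_empty_or_nonempty with h0 | ⟨y, hy⟩
    · exact Or.inl h0
    have hyv : y ≠ v := fun e => hvS (e ▸ hy)
    have : Nontrivial ((↑(insert v S) : Set V)) :=
      ⟨⟨y, by simp [hy]⟩, ⟨v, by simp⟩, by simpa using hyv⟩
    obtain ⟨⟨z, hz⟩, hadj⟩ := hc.preconnected.exists_adj_of_nontrivial ⟨v, by simp⟩
    have hvz : G.Adj v z := hadj
    have hzS : z ∈ S := by
      have : z ∈ insert v S := by exact_mod_cast hz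
      exact (mem_insert.1 this).resolve_left hvz.ne'
    have hzu : z = u := (h.adj_iff z (hS hzS)).1 hvz
    refine Or.inr ⟨hzu ▸ hzS, ?_⟩
    have hp := hc.preconnected.induce_of_degree_eq_one
      (s := {x : (↑(insert v S) : Set V) | x.1 ≠ v}) (by
        rintro ⟨x, hx⟩ hxv
        simp only [ne_eq, Set.mem_ofPred_eq, not_not] at hxv
        subst hxv
        rintro ⟨a, ha⟩ haa ⟨b, hb⟩ hbb
        have haa' : G.Adj x a := haa
        have hbb' : G.Adj x b := hbb
        have ha' : a ∈ S := by
          have : a ∈ insert x S := by exact_mod_cast ha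
          exact (mem_insert.1 this).resolve_left haa'.ne'
        have hb' : b ∈ S := by
          have : b ∈ insert x S := by exact_mod_cast hb
          exact (mem_insert.1 this).resolve_left hbb'.ne'
        have h1 := (h.adj_iff a (hS ha')).1 haa'
        have h2 := (h.adj_iff b (hS hb')).1 hbb'
        simp [h1, h2])
    have : Nonempty (S : Set V) := ⟨⟨y, hy⟩⟩
    refine ⟨?_⟩
    let φ : ((G.induce (↑(insert v S) : Set V)).induce
        {x : (↑(insert v S) : Set V) | x.1 ≠ v}) →g G.induce (S : Set V) :=
      { toFun := fun x => ⟨x.1.1, by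
          have h1 : x.1.1 ∈ insert v S := by exact_mod_cast x.1.2
          have h2 : x.1.1 ≠ v := x.2
          exact_mod_cast (mem_insert.1 h1).resolve_left h2⟩
        map_rel' := fun hab => hab }
    refine hp.map φ ?_
    rintro ⟨x, hx⟩
    have hx' : x ∈ S := by exact_mod_cast hx
    exact ⟨⟨⟨x, by simp [hx']⟩, fun e : x = v => hvS (e ▸ hx')⟩, rfl⟩
  · rintro (rfl | ⟨hu, hc⟩)
    · simpa using connected_singleton G v
    · have := SimpleGraph.connected_induce_union (G := G) (s := {v}) (t := (S : Set V))
        (v := v) (w := u) (by simp)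
        hc.preconnected rfl (by exact_mod_cast hu) h.adj
      rwa [← Set.insert_eq, ← coe_insert] at this

/-- The subgraph induced on the finite vertex set `s` is a tree. -/
def TreeOn (G : SimpleGraph V) (s : Finset V) : Prop := (G.induce (s : Set V)).IsTree

lemma TreeOn.nonempty {s : Finset V} (h : TreeOn G s) : s.Nonempty := by
  obtain ⟨⟨x, hx⟩⟩ := h.connected.nonempty
  exact ⟨x, by exact_mod_cast hx⟩

/-- Removing a leaf from a tree leaves a tree. -/
lemma TreeOn.of_insert {s : Finset V} {v u : V} (h : TreeOn G (insert v s))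
    (hp : Pendant G s v u) : TreeOn G s := by
  refine ⟨?_, ?_⟩
  · rcases (hp.connected_insert_iff subset_rfl).1 h.connected with h0 | h0
    · exact absurd hp.mem (by simp [h0])
    · exact h0.2
  · exact h.isAcyclic.embedding (SimpleGraph.induceHomOfLE G (by simp))

lemma TreeOn.degIn_pos {s : Finset V} {v x : V} (h : TreeOn G s) (hv : v ∈ s) (hx : x ∈ s)
    (hxv : x ≠ v) : 1 ≤ degIn G s v := by
  have : Nontrivial (s : Set V) := ⟨⟨x, hx⟩, ⟨v, hv⟩, by simpa using hxv⟩
  obtain ⟨⟨z, hz⟩, hadj⟩ := h.connected.preconnected.exists_adj_of_nontrivial ⟨v, hv⟩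
  exact card_pos.2 ⟨z, mem_filter.2 ⟨hz, hadj⟩⟩

lemma mem_leavesIn_of_degree {s : Finset V} {v : (s : Set V)}
    [Fintype ((G.induce (s : Set V)).neighborSet v)]
    (h : (G.induce (s : Set V)).degree v = 1) : (v : V) ∈ leavesIn G s := by
  obtain ⟨⟨w, hw⟩, hadj, huniq⟩ := SimpleGraph.degree_eq_one_iff_existsUnique_adj.1 h
  refine mem_leavesIn.2 ⟨v.2, card_eq_one.2 ⟨w, ?_⟩⟩
  ext x
  simp only [mem_filter, mem_singleton]
  constructor
  · rintro ⟨hx, ha⟩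
    exact congrArg Subtype.val (huniq ⟨x, hx⟩ ha)
  · rintro rfl
    exact ⟨hw, hadj⟩

lemma TreeOn.exists_leaf_ne {s : Finset V} (h : TreeOn G s) (b : V) (hs : 2 ≤ #s) :
    ∃ v ∈ leavesIn G s, v ≠ b := by
  have : Nontrivial (s : Set V) := by
    have : s.Nontrivial := one_lt_card_iff_nontrivial.1 hs
    exact Set.nontrivial_coe_sort.2 (by exact_mod_cast this)
  obtain ⟨u, v, huv, hu, hv⟩ := SimpleGraph.IsTree.exists_ne_and_degree_eq_one h
  by_cases hub : (u : V) = b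
  · refine ⟨v, mem_leavesIn_of_degree hv, fun e => huv (Subtype.ext (hub.trans e.symm))⟩
  · exact ⟨u, mem_leavesIn_of_degree hu, hub⟩

/-- Leaf-removal form: a tree with another vertex than `b` is a tree containing `b` with one
pendant vertex added. -/
lemma TreeOn.exists_pendant {s : Finset V} (h : TreeOn G s) {b : V} (hb : b ∈ s) (hs : 2 ≤ #s) :
    ∃ s' v u, s = insert v s' ∧ Pendant G s' v u ∧ TreeOn G s' ∧ b ∈ s' := by
  obtain ⟨v, hv, hvb⟩ := h.exists_leaf_ne b hs
  obtain ⟨u, hu⟩ := exists_pendant_of_mem_leavesIn hv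
  have hs' : s = insert v (s.erase v) := (insert_erase (mem_leavesIn.1 hv).1).symm
  exact ⟨s.erase v, v, u, hs', hu, (hs' ▸ h).of_insert hu, mem_erase.2 ⟨hvb.symm, hb⟩⟩

/-! ### Weighted subtree counts -/

/-- The sum of the weights `∏ x ∈ S, f x` of the connected sets `S` with `A ⊆ S ⊆ s`. For `f = 1`
it is the number of subtrees on `s` that contain `A`. -/
noncomputable def wcount (G : SimpleGraph V) (f : V → ℕ) (s A : Finset V) : ℕ :=
  ∑ S ∈ s.powerset with ConnectedOn G S ∧ A ⊆ S, ∏ x ∈ S, f x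

variable {f : V → ℕ} {s : Finset V} {v u : V}

lemma wcount_congr {g : V → ℕ} {A : Finset V} (h : ∀ x ∈ s, f x = g x) :
    wcount G f s A = wcount G g s A := by
  refine sum_congr rfl fun S hS => prod_congr rfl fun x hx => h x ?_
  exact mem_powerset.1 (mem_filter.1 hS).1 hx

lemma wcount_mono {A B : Finset V} (h : A ⊆ B) : wcount G f s B ≤ wcount G f s A := by
  refine sum_le_sum_of_subset fun S => ?_
  simp only [mem_filter]
  exact fun hS => ⟨hS.1, hS.2.1, h.trans hS.2.2⟩

lemma wcount_singleton (A : Finset V) (hA : A ⊆ {v}) : wcount G f {v} A = f v := by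
  have : ({v} : Finset V).powerset.filter
      (fun S => ConnectedOn G S ∧ A ⊆ S) = {{v}} := by
    ext S
    simp only [mem_filter, mem_powerset, mem_singleton, subset_singleton_iff]
    constructor
    · rintro ⟨rfl | rfl, h⟩
      · exact absurd h.1 (not_connected_empty G)
      · rfl
    · rintro rfl
      exact ⟨Or.inr rfl, connected_singleton G v, hA⟩
  rw [wcount, this, sum_singleton, prod_singleton]

/-- Split the sets according to whether they contain `v`. -/
lemma wcount_insert {A : Finset V} (hv : v ∉ s) :
    wcount G f (insert v s) A = wcount G f s A + wcount G f (insert v s) (insert v A) := by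
  unfold wcount
  rw [← sum_filter_add_sum_filter_not ((insert v s).powerset.filter _) (fun S => v ∉ S)]
  congr 1
  · refine sum_congr ?_ fun _ _ => rfl
    ext S
    simp only [mem_filter, mem_powerset]
    constructor
    · rintro ⟨⟨h1, h2⟩, h3⟩
      exact ⟨(subset_insert_iff_of_notMem h3).1 h1, h2⟩
    · rintro ⟨h1, h2⟩
      exact ⟨⟨h1.trans (subset_insert _ _), h2⟩, fun h => hv (h1 h)⟩
  · refine sum_congr ?_ fun _ _ => rfl
    ext S
    simp only [mem_filter, mem_powerset, not_not, insert_subset_iff]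
    tauto

/-- The connected sets through a pendant vertex `v` and another set `A`. -/
lemma Pendant.wcount_insert_insert {A : Finset V} (h : Pendant G s v u) (hv : v ∉ A)
    (hA : A.Nonempty) :
    wcount G f (insert v s) (insert v A) = f v * wcount G f s (insert u A) := by
  unfold wcount
  rw [mul_sum]
  symm
  refine sum_bij' (fun S _ => insert v S) (fun S _ => S.erase v) ?_ ?_ ?_ ?_ ?_
  · intro S hS
    simp only [mem_filter, mem_powerset, insert_subset_iff] at hS ⊢
    exact ⟨⟨mem_insert_self _ _, hS.1.trans (subset_insert _ _)⟩,
      (h.connected_insert_iff hS.1).2 (Or.inr ⟨hS.2.2.1, hS.2.1⟩), mem_insert_self _ _,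
      hS.2.2.2.trans (subset_insert _ _)⟩
  · intro S hS
    simp only [mem_filter, mem_powerset, insert_subset_iff] at hS ⊢
    obtain ⟨h1, h2, h3, h4⟩ := hS
    have h1' : S.erase v ⊆ s := by rwa [← subset_insert_iff]
    rw [← insert_erase h3, h.connected_insert_iff h1'] at h2
    have hA' : A ⊆ S.erase v := fun x hx =>
      mem_erase.2 ⟨fun e => hv (e ▸ hx), h4 hx⟩
    rcases h2 with h2 | h2
    · obtain ⟨x, hx⟩ := hA
      exact absurd (hA' hx) (by simp [h2])
    · exact ⟨h1', h2.2, h2.1, hA'⟩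
  · intro S hS
    simp only [mem_filter, mem_powerset] at hS
    exact erase_insert fun hvS => h.notMem (hS.1 hvS)
  · intro S hS
    simp only [mem_filter, mem_powerset, insert_subset_iff] at hS
    exact insert_erase hS.2.2.1
  · intro S hS
    simp only [mem_filter, mem_powerset] at hS
    rw [prod_insert fun hvS => h.notMem (hS.1 hvS)]

lemma Pendant.wcount_insert_singleton (h : Pendant G s v u) :
    wcount G f (insert v s) {v} = f v * (1 + wcount G f s {u}) := by
  have hvu : v ∉ ({u} : Finset V) := by simpa using h.ne
  have h1 : wcount G f (insert v s) {v} = f v + wcount G f (insert v s) {v, u} := by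
    unfold wcount
    have : (insert v s).powerset.filter (fun S => ConnectedOn G S ∧ {v} ⊆ S) =
        insert {v} ((insert v s).powerset.filter
          (fun S => ConnectedOn G S ∧ {v, u} ⊆ S)) := by
      ext S
      simp only [mem_filter, mem_powerset, mem_insert, insert_subset_iff, singleton_subset_iff]
      constructor
      · rintro ⟨h1, h2, h3⟩
        have h1' : S.erase v ⊆ s := by rwa [← subset_insert_iff]
        have h2' := h2
        rw [← insert_erase h3, h.connected_insert_iff h1'] at h2'
        rcases h2' with h2' | h2'
        · left
          rw [← insert_erase h3, h2']
          rfl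
        · exact Or.inr ⟨h1, h2, h3, mem_of_mem_erase h2'.1⟩
      · rintro (rfl | h')
        · exact ⟨by simp, connected_singleton G v, mem_singleton_self v⟩
        · exact ⟨h'.1, h'.2.1, h'.2.2.1⟩
    rw [this, sum_insert, prod_singleton]
    simp [insert_subset_iff, h.ne.symm]
  rw [h1, h.wcount_insert_insert hvu (singleton_nonempty u)]
  simp only [mem_singleton, insert_eq_of_mem]
  ring

/-- Multiplying the weight of `u` by `c`. -/
lemma wcount_update (u : V) (c : ℕ) :
    wcount G (Function.update f u (f u * c)) s ∅ + wcount G f s {u} =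
      wcount G f s ∅ + c * wcount G f s {u} := by
  have split : ∀ g : V → ℕ, wcount G g s ∅ =
      (∑ S ∈ s.powerset with ConnectedOn G S ∧ u ∉ S, ∏ x ∈ S, g x) +
        wcount G g s {u} := by
    intro g
    unfold wcount
    rw [← sum_filter_add_sum_filter_not (s.powerset.filter _) (fun S => u ∉ S)]
    congr 1
    · rw [filter_filter]
      simp
    · rw [filter_filter]
      simp
  have h1 : wcount G (Function.update f u (f u * c)) s {u} = c * wcount G f s {u} := by
    unfold wcount
    rw [mul_sum]
    refine sum_congr rfl fun S hS => ?_
    have hu : u ∈ S := by simpa using (mem_filter.1 hS).2.2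
    rw [prod_update_of_mem hu, ← mul_prod_erase S f hu, sdiff_singleton_eq_erase]
    ring
  have h2 : (∑ S ∈ s.powerset with ConnectedOn G S ∧ u ∉ S,
      ∏ x ∈ S, Function.update f u (f u * c) x) =
      ∑ S ∈ s.powerset with ConnectedOn G S ∧ u ∉ S, ∏ x ∈ S, f x := by
    refine sum_congr rfl fun S hS => prod_update_of_notMem (mem_filter.1 hS).2.2 _ _
  rw [split (Function.update _ _ _), split f, h1, h2]
  ring

/-- Pendant removal absorbs the pendant vertex into the weight of its neighbour. -/
lemma Pendant.wcount_insert_empty (h : Pendant G s v u) :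
    wcount G f (insert v s) ∅ =
      f v + wcount G (Function.update f u (f u * (1 + f v))) s ∅ := by
  have h1 := wcount_insert (G := G) (f := f) (A := ∅) h.notMem
  have h2 := h.wcount_insert_singleton (f := f)
  have h3 := wcount_update (G := G) (f := f) (s := s) u (1 + f v)
  rw [insert_empty_eq] at h1
  rw [h1, h2]
  linarith

lemma wcount_one_singleton_lt {A : Finset V} (hA : ¬ A ⊆ {v}) (hv : v ∈ s) (hvA : v ∈ A) :
    wcount G 1 s A < wcount G 1 s {v} := by
  refine sum_lt_sum_of_subset (i := {v}) ?_ ?_ ?_ (by simp) (by simp)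
  · intro S
    simp only [mem_filter]
    exact fun hS => ⟨hS.1, hS.2.1, (singleton_subset_iff.2 hvA).trans hS.2.2⟩
  · simp only [mem_filter, mem_powerset, singleton_subset_iff, hv, true_and]
    exact ⟨connected_singleton G v, mem_singleton_self v⟩
  · simp only [mem_filter, not_and]
    exact fun _ _ => hA

end

section

variable {V : Type*} {G : SimpleGraph V}

/-! ### Legs -/

/-- `Leg G s' c s l v`: the set `s` arises from `s'` by successively attaching `l` pendant
vertices, the first one to `c` and every other one to its predecessor; the last one is `v`
(with `v = c` if `l = 0`). -/
inductive Leg (G : SimpleGraph V) (s' : Finset V) (c : V) : Finset V → ℕ → V → Prop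
  | nil : Leg G s' c s' 0 c
  | snoc {s : Finset V} {l : ℕ} {u v : V} (h : Leg G s' c s l u) (hp : Pendant G s v u) :
      Leg G s' c (insert v s) (l + 1) v

variable {s' s : Finset V} {c v b : V} {l : ℕ}

lemma Leg.subset (h : Leg G s' c s l v) : s' ⊆ s := by
  induction h with
  | nil => exact subset_rfl
  | snoc _ _ ih => exact ih.trans (subset_insert _ _)

lemma Leg.card_eq (h : Leg G s' c s l v) : #s = #s' + l := by
  induction h with
  | nil => rfl
  | snoc _ hp ih => rw [card_insert_of_notMem hp.notMem, ih, add_assoc]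

lemma Leg.wcount_of_nonempty (h : Leg G s' c s l v) {A : Finset V} (hA : A ⊆ s')
    (hA' : A.Nonempty) :
    wcount G 1 s (insert v A) = wcount G 1 s' (insert c A) ∧
      wcount G 1 s A = wcount G 1 s' A + l * wcount G 1 s' (insert c A) := by
  induction h with
  | nil => simp
  | snoc h hp ih =>
    have hv := fun hv => hp.notMem (h.subset (hA hv))
    have h1 := hp.wcount_insert_insert (f := 1) hv hA'
    have h2 := wcount_insert (G := G) (f := 1) (A := A) hp.notMem
    rw [ih.1, Pi.one_apply, one_mul] at h1
    refine ⟨h1, ?_⟩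
    rw [h2, h1, ih.2]
    ring

lemma Leg.wcount_empty (h : Leg G s' c s l v) :
    wcount G 1 s {v} = l + wcount G 1 s' {c} ∧
      wcount G 1 s ∅ = wcount G 1 s' ∅ + (l + 1).choose 2 + l * wcount G 1 s' {c} := by
  induction h with
  | nil => simp
  | @snoc s l u v h hp ih =>
    have h1 := hp.wcount_insert_singleton (f := 1)
    have h2 := wcount_insert (G := G) (f := 1) (A := ∅) hp.notMem
    rw [ih.1, Pi.one_apply, one_mul] at h1
    refine ⟨by rw [h1]; ring, ?_⟩
    rw [h2, insert_empty_eq, h1, ih.2, Nat.choose_succ_succ' (l + 1) 1, Nat.choose_one_right]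
    ring

/-- Coordinates on a leg: `p i` is its `i`-th vertex, counted from `p 0 = c`. -/
structure LegCoord (G : SimpleGraph V) (s' : Finset V) (c : V) (s : Finset V) (l : ℕ)
    (p : ℕ → V) : Prop where
  zero : p 0 = c
  notMem : ∀ i, 1 ≤ i → i ≤ l → p i ∉ s'
  inj : ∀ i j, 1 ≤ i → i ≤ l → 1 ≤ j → j ≤ l → p i = p j → i = j
  cover : ∀ x, x ∈ s ↔ x ∈ s' ∨ ∃ i, 1 ≤ i ∧ i ≤ l ∧ p i = x
  adj_base : ∀ i, 1 ≤ i → i ≤ l → ∀ x ∈ s', G.Adj (p i) x ↔ i = 1 ∧ x = c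
  adj : ∀ i j, 1 ≤ i → i ≤ l → 1 ≤ j → j ≤ l → (G.Adj (p i) (p j) ↔ i + 1 = j ∨ j + 1 = i)

lemma Leg.exists_coord (h : Leg G s' c s l v) : ∃ p, LegCoord G s' c s l p ∧ p l = v := by
  induction h with
  | nil =>
    exact ⟨fun _ => c, ⟨rfl, by omega, by omega, by grind, by omega, by omega⟩, rfl⟩
  | @snoc s l u v h hp ih =>
    obtain ⟨p, hpc, hpl⟩ := ih
    have hs := h.subset
    have hmem : ∀ i, 1 ≤ i → i ≤ l → p i ∈ s := fun i h1 h2 =>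
      (hpc.cover _).2 (Or.inr ⟨i, h1, h2, rfl⟩)
    have hvs := hp.notMem
    have hadj := hp.adj_iff
    have h0 := hpc.zero
    refine ⟨fun i => if i = l + 1 then v else p i, ⟨by simpa using h0, ?_, ?_, ?_, ?_, ?_⟩, by simp⟩
    · intro i h1 h2
      have := hpc.notMem i h1
      grind
    · intro i j h1 h2 h3 h4
      have := hpc.inj i j h1
      grind
    · intro x
      rw [mem_insert, hpc.cover x]
      constructor
      · rintro (rfl | h | ⟨i, h1, h2, h3⟩)
        · exact Or.inr ⟨l + 1, by omega, le_rfl, by simp⟩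
        · exact Or.inl h
        · exact Or.inr ⟨i, h1, by omega, by grind⟩
      · rintro (h | ⟨i, h1, h2, h3⟩)
        · exact Or.inr (Or.inl h)
        · by_cases hi : i = l + 1
          · simp [hi] at h3
            exact Or.inl h3.symm
          · exact Or.inr (Or.inr ⟨i, h1, by omega, by simpa [hi] using h3⟩)
    · intro i h1 h2 x hx
      by_cases hi : i = l + 1
      · simp only [hi, if_true]
        rw [hadj x (hs hx)]
        rcases Nat.eq_zero_or_pos l with rfl | hl
        · simp [← hpl, h0]
        · have := hpc.notMem l hl le_rfl
          constructor
          · rintro rfl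
            exact absurd hx (hpl ▸ this)
          · omega
      · simp only [hi, if_false]
        exact hpc.adj_base i h1 (by omega) x hx
    · intro i j h1 h2 h3 h4
      by_cases hi : i = l + 1 <;> by_cases hj : j = l + 1
      · simp [hi, hj]
      · simp only [hi, hj, if_true, if_false]
        rw [hadj _ (hmem j h3 (by omega)), ← hpl]
        constructor
        · intro h
          have := hpc.inj j l h3 (by omega) (by omega) le_rfl h
          omega
        · intro h
          congr 1
          omega
      · simp only [hi, hj, if_true, if_false]
        rw [G.adj_comm, hadj _ (hmem i h1 (by omega)), ← hpl]
        constructor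
        · intro h
          have := hpc.inj i l h1 (by omega) (by omega) le_rfl h
          omega
        · intro h
          congr 1
          omega
      · simp only [hi, hj, if_false]
        exact hpc.adj i j h1 (by omega) h3 (by omega)

lemma LegCoord.leg {p : ℕ → V} (h : LegCoord G s' c s l p) (hc : c ∈ s') :
    Leg G s' c s l (p l) := by
  induction l generalizing s with
  | zero =>
    have : s = s' := by
      ext x
      rw [h.cover x]
      constructor
      · rintro (h | ⟨i, h1, h2, -⟩)
        · exact h
        · omega
      · exact Or.inl
    rw [this, h.zero]
    exact Leg.nil
  | succ l ih =>
    have hmem : p (l + 1) ∈ s := (h.cover _).2 (Or.inr ⟨l + 1, by omega, le_rfl, rfl⟩)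
    have hnot := h.notMem (l + 1) (by omega) le_rfl
    have hcov : ∀ x, x ∈ s.erase (p (l + 1)) ↔ x ∈ s' ∨ ∃ i, 1 ≤ i ∧ i ≤ l ∧ p i = x := by
      intro x
      rw [mem_erase, h.cover x]
      constructor
      · rintro ⟨h1, h2 | ⟨i, h2, h3, h4⟩⟩
        · exact Or.inl h2
        · refine Or.inr ⟨i, h2, ?_, h4⟩
          have : i ≠ l + 1 := fun e => h1 (by rw [← h4, e])
          omega
      · rintro (h1 | ⟨i, h1, h2, rfl⟩)
        · exact ⟨fun e => hnot (e ▸ h1), Or.inl h1⟩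
        · refine ⟨fun e => ?_, Or.inr ⟨i, h1, by omega, rfl⟩⟩
          have := h.inj i (l + 1) h1 (by omega) (by omega) le_rfl e
          omega
    have hleg : Leg G s' c (s.erase (p (l + 1))) l (p l) :=
      ih ⟨h.zero, fun i h1 h2 => h.notMem i h1 (by omega),
        fun i j h1 h2 h3 h4 => h.inj i j h1 (by omega) h3 (by omega), hcov,
        fun i h1 h2 => h.adj_base i h1 (by omega),
        fun i j h1 h2 h3 h4 => h.adj i j h1 (by omega) h3 (by omega)⟩
    have hpend : Pendant G (s.erase (p (l + 1))) (p (l + 1)) (p l) := by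
      refine ⟨by simp, ?_, ?_⟩
      · rw [hcov]
        rcases Nat.eq_zero_or_pos l with rfl | hl
        · exact Or.inl (h.zero ▸ hc)
        · exact Or.inr ⟨l, hl, le_rfl, rfl⟩
      · intro x hx
        rcases (hcov x).1 hx with hx | ⟨i, h1, h2, rfl⟩
        · rw [h.adj_base _ (by omega) le_rfl x hx]
          rcases Nat.eq_zero_or_pos l with rfl | hl
          · simp [h.zero]
          · constructor
            · omega
            · rintro rfl
              exact absurd hx (h.notMem l hl (by omega))
        · rw [h.adj _ _ (by omega) le_rfl h1 (by omega)]
          constructor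
          · intro h
            congr 1
            omega
          · intro h'
            have := h.inj i l h1 (by omega) (by omega) (by omega) h'
            omega
    have := hleg.snoc hpend
    rwa [insert_erase hmem] at this

lemma Pendant.leavesIn_erase_erase {s : Finset V} {v u b : V} (hp : Pendant G s v u)
    (hu : u ≠ b → (u ∈ leavesIn G s ↔ u ∈ leavesIn G (insert v s))) :
    (leavesIn G s).erase b = ((leavesIn G (insert v s)).erase b).erase v := by
  ext x
  simp only [mem_erase]
  by_cases hxb : x = b
  · simp [hxb]
  by_cases hxv : x = v
  · simp [hxv, mem_leavesIn, hp.notMem]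
  by_cases hxu : x = u
  · subst hxu
    simp [hxv, hxb, hu hxb]
  simp only [ne_eq, hxb, not_false_eq_true, true_and, hxv, mem_leavesIn, mem_insert, false_or]
  constructor
  · rintro ⟨h1, h2⟩
    exact ⟨h1, by rwa [hp.degIn_insert_of_ne h1 hxu]⟩
  · rintro ⟨h1, h2⟩
    exact ⟨h1, by rwa [hp.degIn_insert_of_ne h1 hxu] at h2⟩

/-- Walking from a leaf `v ≠ b` until `b` or a vertex of degree at least three is met, one finds
a leg whose removal destroys the leaf `v` and no other leaf, and creates none except possibly
`b`. -/
lemma exists_leg_of_leaf (ht : TreeOn G s) (hb : b ∈ s) (hv : v ∈ leavesIn G s) (hvb : v ≠ b) :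
    ∃ s' c l, 1 ≤ l ∧ Leg G s' c s l v ∧ TreeOn G s' ∧ b ∈ s' ∧ c ∈ s' ∧
      (c = b ∨ 2 ≤ degIn G s' c) ∧
      (leavesIn G s').erase b = ((leavesIn G s).erase b).erase v := by
  induction hn : #s generalizing s v with
  | zero => simp [card_eq_zero.1 hn] at hb
  | succ n ih =>
    obtain ⟨u, hu⟩ := exists_pendant_of_mem_leavesIn hv
    have hs : s = insert v (s.erase v) := (insert_erase (mem_leavesIn.1 hv).1).symm
    generalize s.erase v = s₁ at hu hs
    subst hs
    have ht₁ := ht.of_insert hu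
    have hb₁ : b ∈ s₁ := (mem_insert.1 hb).resolve_left hvb.symm
    rw [card_insert_of_notMem hu.notMem, add_left_inj] at hn
    have hdeg := hu.degIn_insert
    by_cases hcease : u = b ∨ 2 ≤ degIn G s₁ u
    · refine ⟨s₁, u, 1, le_rfl, Leg.nil.snoc hu, ht₁, hb₁, hu.mem, hcease, ?_⟩
      refine Pendant.leavesIn_erase_erase hu fun hub => ?_
      have := hcease.resolve_left hub
      simp only [mem_leavesIn]
      omega
    · push Not at hcease
      have hpos := ht₁.degIn_pos hu.mem hb₁ hcease.1.symm
      have hu₁ : u ∈ leavesIn G s₁ := mem_leavesIn.2 ⟨hu.mem, by omega⟩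
      obtain ⟨s', c, l, hl, hleg, ht', hb', hc', hcb, hlv⟩ := ih ht₁ hb₁ hu₁ hcease.1 hn
      refine ⟨s', c, l + 1, by omega, hleg.snoc hu, ht', hb', hc', hcb, ?_⟩
      rw [hlv]
      ext x
      simp only [mem_erase]
      by_cases hxb : x = b
      · simp [hxb]
      by_cases hxv : x = v
      · simp [hxv, mem_leavesIn, hu.notMem]
      by_cases hxu : x = u
      · subst hxu
        simp only [mem_leavesIn]
        simp
        omega
      simp only [ne_eq, hxb, not_false_eq_true, true_and, hxv, hxu, mem_leavesIn, mem_insert,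
        false_or]
      constructor
      · rintro ⟨h1, h2⟩
        exact ⟨h1, by rwa [hu.degIn_insert_of_ne h1 hxu]⟩
      · rintro ⟨h1, h2⟩
        exact ⟨h1, by rwa [hu.degIn_insert_of_ne h1 hxu] at h2⟩

/-! ### Spiders inside a graph -/

/-- Coordinates on a spider with vertex set `s`, center `b` and leg lengths `l`: the vertex `f i j`,
for `1 ≤ j ≤ l i`, is the vertex of the `i`-th leg at distance `j` from the center. -/
structure SpiderCoord (G : SimpleGraph V) (s : Finset V) (b : V) {k : ℕ} (l : Fin k → ℕ)
    (f : Fin k → ℕ → V) : Prop where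
  cover : ∀ x, x ∈ s ↔ x = b ∨ ∃ i j, 1 ≤ j ∧ j ≤ l i ∧ f i j = x
  ne_center : ∀ i j, 1 ≤ j → j ≤ l i → f i j ≠ b
  inj : ∀ i j i' j', 1 ≤ j → j ≤ l i → 1 ≤ j' → j' ≤ l i' → f i j = f i' j' → i = i' ∧ j = j'
  adj_center : ∀ i j, 1 ≤ j → j ≤ l i → (G.Adj (f i j) b ↔ j = 1)
  adj : ∀ i j i' j', 1 ≤ j → j ≤ l i → 1 ≤ j' → j' ≤ l i' →
    (G.Adj (f i j) (f i' j') ↔ i = i' ∧ (j + 1 = j' ∨ j' + 1 = j))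

/-- The subgraph induced on `s` is a spider with center `b` and leg lengths `l`. -/
def IsSpiderOn (G : SimpleGraph V) (s : Finset V) (b : V) {k : ℕ} (l : Fin k → ℕ) : Prop :=
  ∃ f, SpiderCoord G s b l f

variable {k : ℕ}

lemma IsSpiderOn.center_mem {l : Fin k → ℕ} (h : IsSpiderOn G s b l) : b ∈ s := by
  obtain ⟨f, hf⟩ := h
  exact (hf.cover b).2 (Or.inl rfl)

lemma isSpiderOn_singleton (b : V) (l : Fin 0 → ℕ) : IsSpiderOn G {b} b l :=
  ⟨fun i => i.elim0, by simp, fun i => i.elim0, fun i => i.elim0, fun i => i.elim0,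
    fun i => i.elim0⟩

lemma IsSpiderOn.cons {l : Fin k → ℕ} {m : ℕ} (h : IsSpiderOn G s' b l)
    (hleg : Leg G s' b s m v) : IsSpiderOn G s b (Fin.cons m l : Fin (k + 1) → ℕ) := by
  have hb := h.center_mem
  obtain ⟨f, hf⟩ := h
  obtain ⟨p, hp, -⟩ := hleg.exists_coord
  have hfs : ∀ i j, 1 ≤ j → j ≤ l i → f i j ∈ s' := fun i j h1 h2 =>
    (hf.cover _).2 (Or.inr ⟨i, j, h1, h2, rfl⟩)
  refine ⟨Fin.cons p f, ?_, ?_, ?_, ?_, ?_⟩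
  · intro x
    rw [hp.cover, hf.cover]
    simp only [Fin.exists_fin_succ, Fin.cons_zero, Fin.cons_succ]
    rw [or_assoc]
    exact or_congr Iff.rfl or_comm
  · intro i
    refine Fin.cases ?_ (fun i => ?_) i
    · simp only [Fin.cons_zero]
      exact fun j h1 h2 e => hp.notMem j h1 h2 (e ▸ hb)
    · simpa using hf.ne_center i
  · intro i j i' j'
    refine Fin.cases ?_ (fun i => ?_) i <;> refine Fin.cases ?_ (fun i' => ?_) i' <;>
      simp only [Fin.cons_zero, Fin.cons_succ] <;> intro h1 h2 h3 h4 h5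
    · exact ⟨trivial, hp.inj j j' h1 h2 h3 h4 h5⟩
    · exact absurd (h5 ▸ hfs i' j' h3 h4) (hp.notMem j h1 h2)
    · exact absurd (h5 ▸ hfs i j h1 h2) (hp.notMem j' h3 h4)
    · have := hf.inj i j i' j' h1 h2 h3 h4 h5
      exact ⟨by rw [this.1], this.2⟩
  · intro i
    refine Fin.cases ?_ (fun i => ?_) i
    · simp only [Fin.cons_zero]
      intro j h1 h2
      simp [hp.adj_base j h1 h2 b hb]
    · simpa using hf.adj_center i
  · intro i j i' j'
    refine Fin.cases ?_ (fun i => ?_) i <;> refine Fin.cases ?_ (fun i' => ?_) i' <;>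
      simp only [Fin.cons_zero, Fin.cons_succ] <;> intro h1 h2 h3 h4
    · simpa using hp.adj j j' h1 h2 h3 h4
    · rw [hp.adj_base j h1 h2 _ (hfs i' j' h3 h4)]
      simp [hf.ne_center i' j' h3 h4, (Fin.succ_ne_zero i').symm]
    · rw [G.adj_comm, hp.adj_base j' h3 h4 _ (hfs i j h1 h2)]
      simp [hf.ne_center i j h1 h2]
    · simpa using hf.adj i j i' j' h1 h2 h3 h4

/-- The first leg of a spider can be detached. -/
lemma IsSpiderOn.exists_leg {l : Fin (k + 1) → ℕ} (h : IsSpiderOn G s b l) :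
    ∃ s' v, Leg G s' b s (l 0) v ∧ IsSpiderOn G s' b (Fin.tail l) := by
  obtain ⟨f, hf⟩ := h
  set s' : Finset V := s \ (Icc 1 (l 0)).image (f 0) with hs'
  have hcov : ∀ x, x ∈ s' ↔ x = b ∨ ∃ i : Fin k, ∃ j, 1 ≤ j ∧ j ≤ l i.succ ∧ f i.succ j = x := by
    intro x
    rw [hs', mem_sdiff, hf.cover, Fin.exists_fin_succ]
    simp only [mem_image, mem_Icc, not_exists, not_and, and_imp]
    constructor
    · rintro ⟨h1 | ⟨j, h1, h2, h3⟩ | h1, h4⟩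
      · exact Or.inl h1
      · exact absurd h3 (h4 j h1 h2)
      · exact Or.inr h1
    · rintro (rfl | ⟨i, j, h1, h2, rfl⟩)
      · exact ⟨Or.inl rfl, fun j h1 h2 => hf.ne_center 0 j h1 h2⟩
      · refine ⟨Or.inr (Or.inr ⟨i, j, h1, h2, rfl⟩), fun j' h3 h4 e => ?_⟩
        exact absurd (hf.inj _ _ _ _ h3 h4 h1 h2 e).1 (Fin.succ_ne_zero i).symm
  refine ⟨s', _, LegCoord.leg (p := fun j => if j = 0 then b else f 0 j)
    ⟨by simp, ?_, ?_, ?_, ?_, ?_⟩ ((hcov b).2 (Or.inl rfl)), fun i => f i.succ, hcov, fun i => hf.ne_center _, ?_,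
    fun i => hf.adj_center _, ?_⟩
  · intro i h1 h2
    rw [if_neg (by omega), hs', mem_sdiff]
    exact fun h => h.2 (mem_image_of_mem _ (mem_Icc.2 ⟨h1, h2⟩))
  · intro i j h1 h2 h3 h4
    rw [if_neg (by omega), if_neg (by omega)]
    exact fun h => (hf.inj _ _ _ _ h1 h2 h3 h4 h).2
  · intro x
    rw [hcov, hf.cover, Fin.exists_fin_succ]
    constructor
    · rintro (h | ⟨j, h1, h2, h3⟩ | h)
      · exact Or.inl (Or.inl h)
      · exact Or.inr ⟨j, h1, h2, by rwa [if_neg (by omega)]⟩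
      · exact Or.inl (Or.inr h)
    · rintro ((h | h) | ⟨j, h1, h2, h3⟩)
      · exact Or.inl h
      · exact Or.inr (Or.inr h)
      · exact Or.inr (Or.inl ⟨j, h1, h2, by rwa [if_neg (by omega)] at h3⟩)
  · intro i h1 h2 x hx
    rw [if_neg (by omega)]
    rcases (hcov x).1 hx with rfl | ⟨i', j, h3, h4, rfl⟩
    · simp [hf.adj_center 0 i h1 h2]
    · simp [hf.adj _ _ _ _ h1 h2 h3 h4, hf.ne_center _ _ h3 h4, (Fin.succ_ne_zero i').symm]
  · intro i j h1 h2 h3 h4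
    rw [if_neg (by omega), if_neg (by omega), hf.adj _ _ _ _ h1 h2 h3 h4]
    simp
  · intro i j i' j' h1 h2 h3 h4 h
    simpa using hf.inj _ _ _ _ h1 h2 h3 h4 h
  · intro i j i' j' h1 h2 h3 h4
    simpa using hf.adj _ _ _ _ h1 h2 h3 h4

lemma IsSpiderOn.wcount {l : Fin k → ℕ} (h : IsSpiderOn G s b l) :
    wcount G 1 s {b} = ∏ i, (l i + 1) ∧
      wcount G 1 s ∅ = ∏ i, (l i + 1) + ∑ i, (l i + 1).choose 2 := by
  induction k generalizing s with
  | zero =>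
    obtain ⟨f, hf⟩ := h
    have : s = {b} := by
      ext x
      simpa using hf.cover x
    simp [this, wcount_singleton]
  | succ k ih =>
    obtain ⟨s', v, hleg, hsp⟩ := h.exists_leg
    obtain ⟨ih1, ih2⟩ := ih hsp
    have h1 := (hleg.wcount_of_nonempty (A := {b}) (by simpa using hsp.center_mem)
      (singleton_nonempty b)).2
    have h2 := hleg.wcount_empty.2
    simp only [Fin.tail, insert_eq_of_mem, mem_singleton] at ih1 ih2 h1
    rw [Fin.prod_univ_succ, Fin.sum_univ_succ]
    constructor
    · rw [h1, ih1]
      ring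
    · rw [h2, ih1, ih2]
      ring

lemma IsSpiderOn.comp_perm {l : Fin k → ℕ} (h : IsSpiderOn G s b l) (σ : Equiv.Perm (Fin k)) :
    IsSpiderOn G s b (l ∘ σ) := by
  obtain ⟨f, hf⟩ := h
  refine ⟨f ∘ σ, ?_, fun i => hf.ne_center _, ?_, fun i => hf.adj_center _, ?_⟩
  · intro x
    rw [hf.cover, σ.surjective.exists]
    rfl
  · intro i j i' j' h1 h2 h3 h4 h
    simpa using hf.inj _ _ _ _ h1 h2 h3 h4 h
  · intro i j i' j' h1 h2 h3 h4
    simpa using hf.adj _ _ _ _ h1 h2 h3 h4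

end

section

/-! ### Leg lengths -/

variable {k n : ℕ}

lemma prod_split (F : ℕ → ℕ) (l : Fin k → ℕ) {i j : Fin k} (hij : i ≠ j) :
    ∏ x, F (l x) = F (l i) * (F (l j) * ∏ x ∈ (univ.erase i).erase j, F (l x)) := by
  rw [mul_prod_erase _ (fun x => F (l x)) (mem_erase.2 ⟨hij.symm, mem_univ j⟩),
    mul_prod_erase _ (fun x => F (l x)) (mem_univ i)]

lemma sum_split (F : ℕ → ℕ) (l : Fin k → ℕ) {i j : Fin k} (hij : i ≠ j) :
    ∑ x, F (l x) = F (l i) + (F (l j) + ∑ x ∈ (univ.erase i).erase j, F (l x)) := by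
  rw [add_sum_erase _ (fun x => F (l x)) (mem_erase.2 ⟨hij.symm, mem_univ j⟩),
    add_sum_erase _ (fun x => F (l x)) (mem_univ i)]

/-- Moving a unit from a long leg to a short one increases the number of subtrees of the spider
through its center and, if there is a third leg, the total number of subtrees. -/
lemma exists_smoothing {l : Fin k → ℕ} (hpos : ∀ i, 1 ≤ l i) {i j : Fin k} (hij : l j + 1 < l i) :
    ∃ l' : Fin k → ℕ, (∀ i, 1 ≤ l' i) ∧ ∑ i, l' i = ∑ i, l i ∧ ∑ i, l' i ^ 2 < ∑ i, l i ^ 2 ∧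
      ∏ i, (l i + 1) < ∏ i, (l' i + 1) ∧
      (3 ≤ k → ∏ i, (l i + 1) + ∑ i, (l i + 1).choose 2 <
        ∏ i, (l' i + 1) + ∑ i, (l' i + 1).choose 2) := by
  have hne : i ≠ j := by
    rintro rfl
    omega
  obtain ⟨t, ht⟩ : ∃ t, l i = l j + 2 + t := ⟨l i - (l j + 2), by omega⟩
  generalize hb : l j = b at *
  set l' : Fin k → ℕ := Function.update (Function.update l i (b + 1 + t)) j (b + 1) with hl'
  have hi : l' i = b + 1 + t := by simp [hl', hne]
  have hj : l' j = b + 1 := by simp [hl']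
  have ho : ∀ x, x ≠ i → x ≠ j → l' x = l x := fun x h1 h2 => by simp [hl', h1, h2]
  have hprod : ∀ F : ℕ → ℕ, ∏ x ∈ (univ.erase i).erase j, F (l' x) =
      ∏ x ∈ (univ.erase i).erase j, F (l x) := fun F => by
    refine prod_congr rfl fun x hx => ?_
    simp only [mem_erase] at hx
    rw [ho x hx.2.1 hx.1]
  have hsum : ∀ F : ℕ → ℕ, ∑ x ∈ (univ.erase i).erase j, F (l' x) =
      ∑ x ∈ (univ.erase i).erase j, F (l x) := fun F => by
    refine sum_congr rfl fun x hx => ?_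
    simp only [mem_erase] at hx
    rw [ho x hx.2.1 hx.1]
  have hR : 1 ≤ ∏ x ∈ (univ.erase i).erase j, (l x + 1) :=
    Nat.one_le_iff_ne_zero.2 (prod_ne_zero_iff.2 fun x _ => by omega)
  have hP := prod_split (· + 1) l hne
  have hP' := prod_split (· + 1) l' hne
  rw [hprod (· + 1), hi, hj] at hP'
  rw [ht, hb] at hP
  have hdiff : ∏ x, (l' x + 1) =
      ∏ x, (l x + 1) + (t + 1) * ∏ x ∈ (univ.erase i).erase j, (l x + 1) := by
    rw [hP, hP']
    ring
  refine ⟨l', ?_, ?_, ?_, ?_, ?_⟩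
  · intro x
    by_cases hxi : x = i
    · rw [hxi, hi]
      omega
    by_cases hxj : x = j
    · rw [hxj, hj]
      omega
    rw [ho x hxi hxj]
    exact hpos x
  · have h1 := sum_split id l hne
    have h2 := sum_split id l' hne
    rw [hsum id] at h2
    simp only [id, hi, hj, ht, hb] at h1 h2
    rw [h1, h2]
    ring
  · rw [sum_split (· ^ 2) l hne, sum_split (· ^ 2) l' hne, hsum (· ^ 2), hi, hj, ht, hb]
    ring_nf
    omega
  · rw [hdiff]
    have := Nat.mul_le_mul (show 1 ≤ t + 1 by omega) hR
    omega
  · intro hk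
    have hR2 : 2 ≤ ∏ x ∈ (univ.erase i).erase j, (l x + 1) := by
      have hcard : 0 < #((univ.erase i).erase j : Finset (Fin k)) := by
        rw [card_erase_of_mem (mem_erase.2 ⟨hne.symm, mem_univ j⟩), card_erase_of_mem (mem_univ i),
          card_univ, Fintype.card_fin]
        omega
      obtain ⟨x, hx⟩ := card_pos.1 hcard
      refine le_trans ?_ (single_le_prod' (f := fun x => l x + 1) (fun _ _ => by simp) hx)
      have := hpos x
      show 2 ≤ l x + 1
      omega
    have hQ := sum_split (fun a => (a + 1).choose 2) l hne
    have hQ' := sum_split (fun a => (a + 1).choose 2) l' hne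
    rw [hsum (fun a => (a + 1).choose 2), hi, hj] at hQ'
    rw [ht, hb] at hQ
    have e1 : (b + 2 + t + 1).choose 2 = (b + 1 + t + 1).choose 2 + (b + 2 + t) := by
      rw [Nat.choose_succ_succ' (b + 2 + t) 1, Nat.choose_one_right,
        show b + 1 + t + 1 = b + 2 + t by ring]
      ring
    have e2 : (b + 1 + 1).choose 2 = (b + 1).choose 2 + (b + 1) := by
      rw [Nat.choose_succ_succ' (b + 1) 1, Nat.choose_one_right]
      ring
    have := Nat.mul_le_mul_left (t + 1) hR2
    rw [hdiff, hQ, hQ', e1, e2]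
    omega

lemma IsBalancedLegs.eq_div_or (hk : 0 < k) {l : Fin k → ℕ} (h : IsBalancedLegs n l) :
    (∀ i, l i = (n - 1) / k ∨ l i = (n - 1) / k + 1) ∧
      #{i | l i = (n - 1) / k + 1} = (n - 1) % k := by
  obtain ⟨i₀, -, hmin⟩ := exists_min_image univ l ⟨⟨0, hk⟩, mem_univ _⟩
  generalize hq : l i₀ = q at hmin
  have hval : ∀ i, l i = q ∨ l i = q + 1 := fun i => by
    have h1 := hmin i (mem_univ i)
    have h2 := h.almost_equal i i₀
    omega
  have hsum : ∑ i, l i = k * q + #{i | l i = q + 1} := by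
    rw [card_filter, show k * q = ∑ _i : Fin k, q by simp, ← sum_add_distrib]
    refine sum_congr rfl fun i _ => ?_
    rcases hval i with h | h <;> simp [h]
  have hlt : #{i | l i = q + 1} < k := by
    conv_rhs => rw [← Fintype.card_fin k, ← card_univ]
    refine card_lt_card ((ssubset_iff_of_subset (subset_univ _)).2 ⟨i₀, mem_univ _, ?_⟩)
    simp [hq]
  have hn : n - 1 = #{i | l i = q + 1} + k * q := by
    have := h.card_eq
    omega
  have hdiv : (n - 1) / k = q := by
    rw [hn, Nat.add_mul_div_left _ _ hk, Nat.div_eq_of_lt hlt, zero_add]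
  refine ⟨by rwa [hdiv], ?_⟩
  rw [hdiv]
  conv_rhs => rw [hn, Nat.add_mul_mod_self_left, Nat.mod_eq_of_lt hlt]

lemma IsBalancedLegs.card_eq_div (hk : 0 < k) {l : Fin k → ℕ} (h : IsBalancedLegs n l) :
    #{i | l i = (n - 1) / k} = k - (n - 1) % k := by
  obtain ⟨h1, h2⟩ := h.eq_div_or hk
  have := card_filter_add_card_filter_not (s := (univ : Finset (Fin k)))
    (fun i => l i = (n - 1) / k + 1)
  have e : (univ.filter fun i => ¬ l i = (n - 1) / k + 1) =
      univ.filter fun i => l i = (n - 1) / k := by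
    ext i
    have := h1 i
    simp only [mem_filter, mem_univ, true_and]
    omega
  rw [e, h2, card_univ, Fintype.card_fin] at this
  omega

/-- Balanced leg lengths are unique up to the order of the legs. -/
lemma IsBalancedLegs.exists_perm {l m : Fin k → ℕ} (hl : IsBalancedLegs n l)
    (hm : IsBalancedLegs n m) : ∃ σ : Equiv.Perm (Fin k), m ∘ σ = l := by
  rcases Nat.eq_zero_or_pos k with rfl | hk
  · exact ⟨1, funext fun i => i.elim0⟩
  have key : ∀ c, Nonempty ({i // l i = c} ≃ {i // m i = c}) := by
    intro c
    refine Fintype.card_eq.1 ?_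
    rw [Fintype.card_subtype, Fintype.card_subtype]
    by_cases h1 : c = (n - 1) / k
    · rw [h1, hl.card_eq_div hk, hm.card_eq_div hk]
    by_cases h2 : c = (n - 1) / k + 1
    · rw [h2, (hl.eq_div_or hk).2, (hm.eq_div_or hk).2]
    rw [filter_eq_empty_iff.2, filter_eq_empty_iff.2]
    · intro i _ e
      have := (hm.eq_div_or hk).1 i
      omega
    · intro i _ e
      have := (hl.eq_div_or hk).1 i
      omega
  exact ⟨Equiv.ofFiberEquiv fun c => (key c).some, funext fun i => Equiv.ofFiberEquiv_map _ i⟩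

/-- Balanced leg lengths maximize the counts of a spider, for at least three legs uniquely. -/
lemma IsBalancedLegs.isMax {m : Fin k → ℕ} (hm : IsBalancedLegs n m) {l : Fin k → ℕ}
    (hpos : ∀ i, 1 ≤ l i) (hsum : 1 + ∑ i, l i = n) :
    ∏ i, (l i + 1) ≤ ∏ i, (m i + 1) ∧
      (3 ≤ k → ∏ i, (l i + 1) + ∑ i, (l i + 1).choose 2 ≤
          ∏ i, (m i + 1) + ∑ i, (m i + 1).choose 2 ∧
        (∏ i, (l i + 1) + ∑ i, (l i + 1).choose 2 =
          ∏ i, (m i + 1) + ∑ i, (m i + 1).choose 2 → IsBalancedLegs n l)) := by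
  induction hN : ∑ i, l i ^ 2 using Nat.strong_induction_on generalizing l with
  | _ N ih =>
    by_cases hbal : ∀ i j, l i ≤ l j + 1
    · have hl : IsBalancedLegs n l := ⟨hpos, hsum, hbal⟩
      obtain ⟨σ, rfl⟩ := hl.exists_perm hm
      have h1 := Equiv.prod_comp σ fun i => m i + 1
      have h2 := Equiv.sum_comp σ fun i => (m i + 1).choose 2
      simp only [Function.comp_apply, h1, h2, le_refl, true_and, hl, implies_true]
    · push Not at hbal
      obtain ⟨i, j, hij⟩ := hbal
      obtain ⟨l', h1, h2, h3, h4, h5⟩ := exists_smoothing hpos hij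
      obtain ⟨ih1, ih2⟩ := ih _ (hN ▸ h3) h1 (h2 ▸ hsum) rfl
      refine ⟨h4.le.trans ih1, fun hk => ?_⟩
      have h6 := (h5 hk).trans_le (ih2 hk).1
      exact ⟨h6.le, fun e => absurd e h6.ne⟩

lemma exists_isBalancedLegs (hk : 0 < k) (hkn : k ≤ n - 1) :
    ∃ l : Fin k → ℕ, IsBalancedLegs n l := by
  refine ⟨fun i => (n - 1) / k + if (i : ℕ) < (n - 1) % k then 1 else 0, ?_, ?_, ?_⟩
  · intro i
    have := Nat.div_pos hkn hk
    omega
  · have h1 := Nat.mod_add_div (n - 1) k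
    have h2 := Nat.mod_lt (n - 1) hk
    rw [sum_add_distrib, sum_const, card_univ, Fintype.card_fin, smul_eq_mul, ← card_filter,
      Fin.card_filter_val_lt, min_eq_right h2.le]
    omega
  · intro i j
    split_ifs <;> omega

lemma IsBalancedLegs.formula (hk : 0 < k) {l : Fin k → ℕ} (h : IsBalancedLegs n l) {i j : ℕ}
    (hij : i + j = k) (hj : n - 1 ≡ j [MOD k]) :
    ∏ x, (l x + 1) + ∑ x, (l x + 1).choose 2 =
      ((n - 1) / k + 1) ^ i * ((n - 1) ⌈/⌉ k + 1) ^ j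
        + i * ((n - 1) / k + 1).choose 2 + j * ((n - 1) ⌈/⌉ k + 1).choose 2 := by
  have hval := (h.eq_div_or hk).1
  have hc1 := (h.eq_div_or hk).2
  have hc0 := h.card_eq_div hk
  have hlt := Nat.mod_lt (n - 1) hk
  have hdm := Nat.div_add_mod (n - 1) k
  have hP : ∏ x, (l x + 1) = ((n - 1) / k + 1) ^ (k - (n - 1) % k) *
      ((n - 1) / k + 1 + 1) ^ ((n - 1) % k) := by
    rw [← prod_filter_mul_prod_filter_not univ (fun x => l x = (n - 1) / k)]
    congr 1
    · rw [← hc0]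
      refine prod_eq_pow_card fun x hx => ?_
      rw [(mem_filter.1 hx).2]
    · rw [← hc1, show (univ.filter fun x => ¬ l x = (n - 1) / k) =
        univ.filter fun x => l x = (n - 1) / k + 1 by
          ext x
          have := hval x
          simp only [mem_filter, mem_univ, true_and]
          omega]
      refine prod_eq_pow_card fun x hx => ?_
      rw [(mem_filter.1 hx).2]
  have hQ : ∑ x, (l x + 1).choose 2 = (k - (n - 1) % k) * ((n - 1) / k + 1).choose 2 +
      ((n - 1) % k) * ((n - 1) / k + 1 + 1).choose 2 := by
    rw [← sum_filter_add_sum_filter_not univ (fun x => l x = (n - 1) / k)]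
    congr 1
    · rw [← hc0]
      refine sum_const_nat fun x hx => ?_
      rw [(mem_filter.1 hx).2]
    · rw [← hc1, show (univ.filter fun x => ¬ l x = (n - 1) / k) =
        univ.filter fun x => l x = (n - 1) / k + 1 by
          ext x
          have := hval x
          simp only [mem_filter, mem_univ, true_and]
          omega]
      refine sum_const_nat fun x hx => ?_
      rw [(mem_filter.1 hx).2]
  have hjk : (n - 1) % k = j % k := hj
  by_cases hr : (n - 1) % k = 0
  · -- all legs have the same length, and `j` may be `0` or `k`
    have hceil : (n - 1) ⌈/⌉ k = (n - 1) / k := by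
      rw [Nat.ceilDiv_eq_add_pred_div]
      have : n - 1 + k - 1 = (k - 1) + k * ((n - 1) / k) := by omega
      conv_lhs => rw [this, Nat.add_mul_div_left _ _ hk, Nat.div_eq_of_lt (by omega), zero_add]
    rw [hP, hQ, hceil, hr, Nat.sub_zero, ← hij]
    ring
  · have hjlt : j < k := by
      rcases (show j ≤ k by omega).lt_or_eq with h | h
      · exact h
      · rw [h, Nat.mod_self] at hjk
        exact absurd hjk hr
    rw [Nat.mod_eq_of_lt hjlt] at hjk
    have hceil : (n - 1) ⌈/⌉ k = (n - 1) / k + 1 := by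
      rw [Nat.ceilDiv_eq_add_pred_div]
      have : n - 1 + k - 1 = ((n - 1) % k - 1) + k * ((n - 1) / k + 1) := by
        rw [mul_add]
        omega
      conv_lhs => rw [this, Nat.add_mul_div_left _ _ hk, Nat.div_eq_of_lt (by omega), zero_add]
    rw [hP, hQ, hceil, hjk, show k - j = i by omega]
    ring

end

section

variable {V : Type*} {G : SimpleGraph V} {s : Finset V} {b : V} {k n : ℕ}

/-! ### The upper bound -/

lemma one_le_card_of_mem {s : Finset V} (h : b ∈ s) : 1 ≤ #s := card_pos.2 ⟨b, h⟩

lemma TreeOn.eq_singleton_of_leaves (ht : TreeOn G s) (hb : b ∈ s)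
    (h : #((leavesIn G s).erase b) = 0) : s = {b} := by
  by_contra hne
  have h2 : 2 ≤ #s := by
    by_contra h'
    have h1 := one_le_card_of_mem hb
    obtain ⟨x, rfl⟩ := card_eq_one.1 (show #s = 1 by omega)
    rw [mem_singleton.1 hb] at hne
    exact hne rfl
  obtain ⟨v, hv, hvb⟩ := ht.exists_leaf_ne b h2
  exact absurd (mem_erase.2 ⟨hvb, hv⟩) (by simp [card_eq_zero.1 h])

/-- The number of subtrees through a given vertex `b` is at most that of a spider with center `b`,
with as many legs as there are leaves other than `b`; equality forces the tree to be that spider.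
This holds since attaching a leg of length `l` multiplies the count by at most `l + 1`, and by less
if the leg is not attached to `b`. -/
lemma TreeOn.exists_wcount_le (ht : TreeOn G s) (hb : b ∈ s)
    (hk : #((leavesIn G s).erase b) = k) :
    ∃ l : Fin k → ℕ, (∀ i, 1 ≤ l i) ∧ 1 + ∑ i, l i = #s ∧
      wcount G 1 s {b} ≤ ∏ i, (l i + 1) ∧
      (wcount G 1 s {b} = ∏ i, (l i + 1) → IsSpiderOn G s b l) := by
  induction k generalizing s with
  | zero =>
    rw [ht.eq_singleton_of_leaves hb hk]
    exact ⟨fun i => i.elim0, fun i => i.elim0, by simp, by simp [wcount_singleton],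
      fun _ => isSpiderOn_singleton b _⟩
  | succ k ih =>
    obtain ⟨v, hv⟩ : ((leavesIn G s).erase b).Nonempty := card_pos.1 (by omega)
    obtain ⟨s', c, m, hm, hleg, ht', hb', hc', -, hlv⟩ :=
      exists_leg_of_leaf ht hb (mem_of_mem_erase hv) (ne_of_mem_erase hv)
    obtain ⟨l, h1, h2, h3, h4⟩ := ih ht' hb' (by rw [hlv, card_erase_of_mem hv, hk]; rfl)
    have hcount := (hleg.wcount_of_nonempty (A := {b}) (by simpa using hb')
      (singleton_nonempty b)).2
    have hmono : wcount G 1 s' {c, b} ≤ wcount G 1 s' {b} := wcount_mono (by simp)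
    have hmul := Nat.mul_le_mul_left m hmono
    have hmul' := Nat.mul_le_mul_left m h3
    refine ⟨Fin.cons m l, ?_, ?_, ?_, ?_⟩
    · exact Fin.cases hm h1
    · rw [Fin.sum_univ_succ, hleg.card_eq, ← h2]
      simp only [Fin.cons_zero, Fin.cons_succ]
      ring
    · rw [Fin.prod_univ_succ, hcount]
      simp only [Fin.cons_zero, Fin.cons_succ]
      rw [add_mul, one_mul]
      omega
    · rw [Fin.prod_univ_succ, hcount]
      simp only [Fin.cons_zero, Fin.cons_succ]
      rw [add_mul, one_mul]
      intro heq
      have hcb : c = b := by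
        by_contra hcb
        have hlt : wcount G 1 s' {c, b} < wcount G 1 s' {b} :=
          wcount_one_singleton_lt (by simpa [insert_subset_iff] using hcb) hb' (by simp)
        have := Nat.mul_lt_mul_of_pos_left hlt hm
        omega
      subst hcb
      exact (h4 (by omega)).cons hleg

/-- A tree with two leaves is a path. -/
lemma TreeOn.exists_leg_of_card_eq_two (ht : TreeOn G s) (h2 : #(leavesIn G s) = 2) :
    ∃ b v l, Leg G {b} b s l v := by
  obtain ⟨b, hb⟩ : (leavesIn G s).Nonempty := card_pos.1 (by omega)
  have hbs := (mem_leavesIn.1 hb).1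
  have hk : #((leavesIn G s).erase b) = 1 := by rw [card_erase_of_mem hb, h2]
  obtain ⟨v, hv⟩ : ((leavesIn G s).erase b).Nonempty := card_pos.1 (by omega)
  obtain ⟨s', c, m, -, hleg, ht', hb', hc', -, hlv⟩ :=
    exists_leg_of_leaf ht hbs (mem_of_mem_erase hv) (ne_of_mem_erase hv)
  have hs' := ht'.eq_singleton_of_leaves hb' (by rw [hlv, card_erase_of_mem hv, hk])
  subst hs'
  rw [mem_singleton.1 hc'] at hleg
  exact ⟨b, v, m, hleg⟩

lemma choose_two_add (x y : ℕ) :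
    (x + y + 1).choose 2 = (x + 1).choose 2 + (y + 1).choose 2 + x * y := by
  induction y with
  | zero => simp
  | succ y ih =>
    rw [show x + (y + 1) + 1 = (x + y + 1) + 1 by ring, Nat.choose_succ_succ' _ 1, ih,
      Nat.choose_succ_succ' (y + 1) 1, Nat.choose_one_right, Nat.choose_one_right]
    ring

/-- The upper bound for the number of subtrees. One removes a leg ending in a leaf: the bound is
the number of subtrees of the spider whose other legs are balanced. -/
theorem TreeOn.wcount_le (hk : 2 ≤ k) (ht : TreeOn G s) (hlv : #(leavesIn G s) = k)
    {m : Fin k → ℕ} (hm : IsBalancedLegs #s m) :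
    wcount G 1 s ∅ ≤ ∏ i, (m i + 1) + ∑ i, (m i + 1).choose 2 ∧
      (3 ≤ k → wcount G 1 s ∅ = ∏ i, (m i + 1) + ∑ i, (m i + 1).choose 2 →
        ∃ c, IsSpiderOn G s c m) := by
  induction k, hk using Nat.le_induction generalizing s with
  | base =>
    refine ⟨?_, by omega⟩
    obtain ⟨b, v, l, hleg⟩ := ht.exists_leg_of_card_eq_two hlv
    have h1 := hleg.wcount_empty.2
    have h2 := hm.card_eq
    have h3 := hleg.card_eq
    rw [Fin.sum_univ_two, h3, card_singleton] at h2
    have h4 : l = m 0 + m 1 := by omega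
    rw [h1, Fin.prod_univ_two, Fin.sum_univ_two, wcount_singleton ∅ (by simp),
      wcount_singleton {b} subset_rfl, h4, choose_two_add]
    simp only [Pi.one_apply]
    apply le_of_eq
    ring
  | succ k hk ih =>
    -- rooting the tree at a leaf makes the branching vertex `c` an inner vertex of `s'`
    obtain ⟨b, hb⟩ : (leavesIn G s).Nonempty := card_pos.1 (by omega)
    obtain ⟨hbs, hbdeg⟩ := mem_leavesIn.1 hb
    have hkb : #((leavesIn G s).erase b) = k := by rw [card_erase_of_mem hb, hlv]; rfl
    obtain ⟨v, hv⟩ : ((leavesIn G s).erase b).Nonempty := card_pos.1 (by omega)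
    obtain ⟨s', c, l, hl, hleg, ht', hb', hc', hcb, hlv'⟩ :=
      exists_leg_of_leaf ht hbs (mem_of_mem_erase hv) (ne_of_mem_erase hv)
    have hkb' : #((leavesIn G s').erase b) = k - 1 := by rw [hlv', card_erase_of_mem hv, hkb]
    obtain ⟨w, hw⟩ : ((leavesIn G s').erase b).Nonempty := card_pos.1 (by omega)
    have hbpos : 1 ≤ degIn G s' b :=
      ht'.degIn_pos hb' (mem_leavesIn.1 (mem_of_mem_erase hw)).1 (ne_of_mem_erase hw)
    obtain ⟨p, hp, -⟩ := hleg.exists_coord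
    have hbdeg' : degIn G s' b = 1 := by
      refine le_antisymm (le_trans (card_le_card ?_) hbdeg.le) hbpos
      exact filter_subset_filter _ hleg.subset
    have hcb' : c ≠ b := by
      -- the leg would add a neighbour to the leaf `b`
      rintro rfl
      have hp1 : p 1 ∈ s := (hp.cover _).2 (Or.inr ⟨1, le_rfl, hl, rfl⟩)
      have hlt : degIn G s' c < degIn G s c := by
        refine card_lt_card ((ssubset_iff_of_subset (filter_subset_filter _ hleg.subset)).2
          ⟨p 1, ?_, ?_⟩)
        · rw [mem_filter, G.adj_comm, hp.adj_base 1 le_rfl hl c hc']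
          exact ⟨hp1, rfl, rfl⟩
        · rw [mem_filter]
          exact fun h => hp.notMem 1 le_rfl hl h.1
      omega
    have hcdeg := hcb.resolve_left hcb'
    have hlvs' : #(leavesIn G s') = k := by
      have := card_erase_add_one (show b ∈ leavesIn G s' from mem_leavesIn.2 ⟨hb', hbdeg'⟩)
      omega
    have hlvc : #((leavesIn G s').erase c) = k := by
      rw [erase_eq_of_notMem, hlvs']
      exact fun h => absurd (mem_leavesIn.1 h).2 (by omega)
    obtain ⟨l', h1, h2, h3, h4⟩ := ht'.exists_wcount_le hc' hlvc
    have hks' : k ≤ #s' - 1 := by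
      have : ∑ _i : Fin k, 1 ≤ ∑ i, l' i := sum_le_sum fun i _ => h1 i
      rw [sum_const, card_univ, Fintype.card_fin, smul_eq_mul, mul_one] at this
      omega
    obtain ⟨m', hm'⟩ := exists_isBalancedLegs (by omega) hks'
    have hcount := hleg.wcount_empty.2
    have hmax := (hm'.isMax h1 h2).1
    have hcard := hleg.card_eq
    have hcons : ∀ l₁ : Fin k → ℕ, (∀ i, 1 ≤ l₁ i) → 1 + ∑ i, l₁ i = #s' →
        (∀ i, 1 ≤ (Fin.cons l l₁ : Fin (k + 1) → ℕ) i) ∧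
          1 + ∑ i, (Fin.cons l l₁ : Fin (k + 1) → ℕ) i = #s := by
      intro l₁ h5 h6
      refine ⟨Fin.cases hl h5, ?_⟩
      rw [Fin.sum_univ_succ, hcard, ← h6]
      simp only [Fin.cons_zero, Fin.cons_succ]
      ring
    have hmaxc := ((hm.isMax (hcons m' hm'.pos hm'.card_eq).1 (hcons m' hm'.pos hm'.card_eq).2).2
      (by omega)).1
    rw [Fin.prod_univ_succ, Fin.sum_univ_succ] at hmaxc
    simp only [Fin.cons_zero, Fin.cons_succ] at hmaxc
    have hih := (ih ht' hlvs' hm').1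
    have hmul := Nat.mul_le_mul_left l (h3.trans hmax)
    rw [add_mul, one_mul] at hmaxc
    refine ⟨by omega, fun _ heq => ?_⟩
    have hmid : wcount G 1 s' {c} = ∏ i, (m' i + 1) := by
      refine le_antisymm (h3.trans hmax) ?_
      by_contra hlt
      have := Nat.mul_lt_mul_of_pos_left (not_le.1 hlt) hl
      omega
    have hsp := (h4 (by omega)).cons hleg
    obtain ⟨h5, h6⟩ := hcons l' h1 h2
    have hbal := ((hm.isMax h5 h6).2 (by omega)).2 (by rw [← hsp.wcount.2, heq])
    obtain ⟨σ, hσ⟩ := hm.exists_perm hbal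
    exact ⟨c, hσ ▸ hsp.comp_perm σ⟩

/-- A path is a spider with two legs of any lengths with the right sum. -/
lemma Leg.isSpiderOn {v : V} {l : ℕ} (h : Leg G {b} b s l v) {m : Fin 2 → ℕ}
    (hm : m 0 + m 1 = l) : ∃ c, IsSpiderOn G s c m := by
  obtain ⟨p, hp, -⟩ := h.exists_coord
  have h0 := hp.zero
  have hinj : ∀ i j, i ≤ l → j ≤ l → p i = p j → i = j := by
    intro i j hi hj he
    rcases Nat.eq_zero_or_pos i with rfl | hi' <;> rcases Nat.eq_zero_or_pos j with rfl | hj'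
    · rfl
    · exact absurd (by rw [← he, h0]; simp) (hp.notMem j hj' hj)
    · exact absurd (by rw [he, h0]; simp) (hp.notMem i hi' hi)
    · exact hp.inj i j hi' hi hj' hj he
  have hadj : ∀ i j, i ≤ l → j ≤ l → (G.Adj (p i) (p j) ↔ i + 1 = j ∨ j + 1 = i) := by
    intro i j hi hj
    rcases Nat.eq_zero_or_pos i with rfl | hi' <;> rcases Nat.eq_zero_or_pos j with rfl | hj'
    · simp
    · rw [G.adj_comm, h0, hp.adj_base j hj' hj b (by simp)]
      simp
      omega
    · rw [h0, hp.adj_base i hi' hi b (by simp)]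
      simp
      omega
    · exact hp.adj i j hi' hi hj' hj
  have hcov : ∀ x, x ∈ s ↔ ∃ i, i ≤ l ∧ p i = x := by
    intro x
    rw [hp.cover, mem_singleton]
    constructor
    · rintro (rfl | ⟨i, -, h2, h3⟩)
      · exact ⟨0, by omega, h0⟩
      · exact ⟨i, h2, h3⟩
    · rintro ⟨i, h1, h2⟩
      rcases Nat.eq_zero_or_pos i with rfl | hi'
      · exact Or.inl (by rw [← h2, h0])
      · exact Or.inr ⟨i, hi', h1, h2⟩
  refine ⟨p (m 0), fun i j => if i = 0 then p (m 0 - j) else p (m 0 + j), ?_, ?_, ?_, ?_, ?_⟩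
  · intro x
    rw [hcov, Fin.exists_fin_two]
    simp only [if_true, Fin.one_eq_zero_iff, OfNat.ofNat_ne_one, if_false]
    constructor
    · rintro ⟨i, h1, rfl⟩
      rcases lt_trichotomy i (m 0) with h | h | h
      · exact Or.inr (Or.inl ⟨m 0 - i, by omega, by omega, by congr 1; omega⟩)
      · exact Or.inl (by rw [h])
      · exact Or.inr (Or.inr ⟨i - m 0, by omega, by omega, by congr 1; omega⟩)
    · rintro (rfl | ⟨j, h1, h2, rfl⟩ | ⟨j, h1, h2, rfl⟩)
      · exact ⟨_, by omega, rfl⟩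
      · exact ⟨_, by omega, rfl⟩
      · exact ⟨_, by omega, rfl⟩
  · rw [Fin.forall_fin_two]
    constructor <;> intro j h1 h2 h3 <;> simp at h3 <;>
      have := hinj _ _ (by omega) (by omega) h3 <;> omega
  · intro i j i' j'
    fin_cases i <;> fin_cases i' <;> simp <;> intro h1 h2 h3 h4 h5 <;>
      have := hinj _ _ (by omega) (by omega) h5 <;> omega
  · rw [Fin.forall_fin_two]
    constructor <;> intro j h1 h2 <;> simp <;> rw [hadj _ _ (by omega) (by omega)] <;> omega
  · intro i j i' j'
    fin_cases i <;> fin_cases i' <;> simp <;> intro h1 h2 h3 h4 <;>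
      rw [hadj _ _ (by omega) (by omega)] <;> omega

end

section

variable {V : Type*} {G : SimpleGraph V} {s s' : Finset V} {u v b : V} {k n m : ℕ}

/-! ### The lower bound for a weighted tree -/

/-- Induction on trees containing `b`, by adding pendant vertices. -/
lemma TreeOn.induction {P : Finset V → Prop} (b : V) (base : P {b})
    (step : ∀ s v u, TreeOn G (insert v s) → Pendant G s v u → TreeOn G s → b ∈ s → P s →
      P (insert v s)) (ht : TreeOn G s) (hb : b ∈ s) : P s := by
  induction hn : #s generalizing s with
  | zero => simp [card_eq_zero.1 hn] at hb
  | succ n ih =>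
    by_cases hs : 2 ≤ #s
    · obtain ⟨s', v, u, rfl, hp, ht', hb'⟩ := ht.exists_pendant hb hs
      rw [card_insert_of_notMem hp.notMem, add_left_inj] at hn
      exact step s' v u ht hp ht' hb' (ih ht' hb' hn)
    · obtain ⟨x, rfl⟩ := card_eq_one.1 (show #s = 1 by omega)
      rwa [← mem_singleton.1 hb]

variable {f : V → ℕ}

lemma wcount_add_prod_le (ht : TreeOn G (insert v s)) (hv : v ∉ s) {A : Finset V} (hA : A ⊆ s) :
    wcount G f s A + ∏ x ∈ insert v s, f x ≤ wcount G f (insert v s) A := by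
  rw [wcount_insert hv]
  refine Nat.add_le_add_left ?_ _
  refine single_le_sum (f := fun S : Finset V => ∏ x ∈ S, f x) (fun _ _ => Nat.zero_le _) ?_
  exact mem_filter.2 ⟨mem_powerset.2 subset_rfl, ht.connected, insert_subset_insert _ hA⟩

lemma TreeOn.le_wcount_singleton (hf : ∀ x, 1 ≤ f x) (ht : TreeOn G s) (hu : u ∈ s) :
    f u + (#s - 1) ≤ wcount G f s {u} := by
  refine TreeOn.induction (P := fun s => f u + (#s - 1) ≤ wcount G f s {u}) u ?_ ?_ ht hu
  · simp [wcount_singleton]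
  · intro s v x ht hp _ hus ih
    have h1 := wcount_add_prod_le (f := f) ht hp.notMem (singleton_subset_iff.2 hus)
    have h2 : 1 ≤ ∏ x ∈ insert v s, f x := one_le_prod' fun x _ => hf x
    have h3 := one_le_card_of_mem hus
    rw [card_insert_of_notMem hp.notMem]
    omega

/-- Besides `s` itself and `{u}`, there are subtrees through `u` of all sizes in between. -/
lemma TreeOn.prod_add_le_wcount_singleton (hf : ∀ x, 1 ≤ f x) (ht : TreeOn G s) (hu : u ∈ s)
    (hs : 2 ≤ #s) : ∏ x ∈ s, f x + f u + (#s - 2) ≤ wcount G f s {u} := by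
  obtain ⟨s', v, x, rfl, hp, ht', hu'⟩ := ht.exists_pendant hu hs
  have h1 := wcount_add_prod_le (f := f) ht hp.notMem (singleton_subset_iff.2 hu')
  have h2 := ht'.le_wcount_singleton hf hu'
  rw [card_insert_of_notMem hp.notMem]
  omega

/-- Coordinates `p 0, …, p (m - 1)` on a path with vertex set `s`. -/
structure PathCoord (G : SimpleGraph V) (s : Finset V) (m : ℕ) (p : ℕ → V) : Prop where
  cover : ∀ x, x ∈ s ↔ ∃ i < m, p i = x
  inj : ∀ i < m, ∀ j < m, p i = p j → i = j
  adj : ∀ i < m, ∀ j < m, (G.Adj (p i) (p j) ↔ i + 1 = j ∨ j + 1 = i)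

lemma PathCoord.mem {p : ℕ → V} (h : PathCoord G s m p) {i : ℕ} (hi : i < m) : p i ∈ s :=
  (h.cover _).2 ⟨i, hi, rfl⟩

lemma PathCoord.card_eq {p : ℕ → V} (h : PathCoord G s m p) : #s = m := by
  have : s = (range m).image p := by
    ext x
    simp [h.cover]
  rw [this, card_image_of_injOn, card_range]
  intro i hi j hj
  exact h.inj i (by simpa using hi) j (by simpa using hj)

lemma PathCoord.reverse {p : ℕ → V} (h : PathCoord G s m p) :
    PathCoord G s m fun i => p (m - 1 - i) := by
  refine ⟨fun x => ?_, fun i hi j hj e => ?_, fun i hi j hj => ?_⟩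
  · rw [h.cover]
    constructor
    · rintro ⟨i, hi, rfl⟩
      exact ⟨m - 1 - i, by omega, by congr 1; omega⟩
    · rintro ⟨i, hi, rfl⟩
      exact ⟨m - 1 - i, by omega, rfl⟩
  · have := h.inj _ (by omega) _ (by omega) e
    omega
  · rw [h.adj _ (by omega) _ (by omega)]
    omega

lemma PathCoord.insert_pendant {p : ℕ → V} (h : PathCoord G s m p) (hm : 0 < m)
    (hp : Pendant G s v (p (m - 1))) :
    PathCoord G (insert v s) (m + 1) (Function.update p m v) := by
  have hlt : ∀ i < m, Function.update p m v i = p i := fun i hi => by simp [hi.ne]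
  have hmm : Function.update p m v m = v := by simp
  refine ⟨fun x => ?_, fun i hi j hj e => ?_, fun i hi j hj => ?_⟩
  · rw [mem_insert, h.cover]
    constructor
    · rintro (rfl | ⟨i, hi, rfl⟩)
      · exact ⟨m, by omega, hmm⟩
      · exact ⟨i, by omega, hlt i hi⟩
    · rintro ⟨i, hi, rfl⟩
      rcases Nat.lt_succ_iff_lt_or_eq.1 hi with hi | rfl
      · exact Or.inr ⟨i, hi, (hlt i hi).symm⟩
      · exact Or.inl hmm
  · rcases Nat.lt_succ_iff_lt_or_eq.1 hi with hi | rfl <;>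
      rcases Nat.lt_succ_iff_lt_or_eq.1 hj with hj | rfl
    · rw [hlt i hi, hlt j hj] at e
      exact h.inj i hi j hj e
    · rw [hlt i hi, hmm] at e
      exact absurd (e ▸ h.mem hi) hp.notMem
    · rw [hlt j hj, hmm] at e
      exact absurd (e ▸ h.mem hj) hp.notMem
    · rfl
  · rcases Nat.lt_succ_iff_lt_or_eq.1 hi with hi | rfl <;>
      rcases Nat.lt_succ_iff_lt_or_eq.1 hj with hj | rfl
    · rw [hlt i hi, hlt j hj]
      exact h.adj i hi j hj
    · rw [hlt i hi, hmm, G.adj_comm, hp.adj_iff _ (h.mem hi)]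
      constructor
      · intro e
        have := h.inj i hi _ (by omega) e
        omega
      · intro e
        congr 1
        omega
    · rw [hlt j hj, hmm, hp.adj_iff _ (h.mem hj)]
      constructor
      · intro e
        have := h.inj j hj _ (by omega) e
        omega
      · intro e
        congr 1
        omega
    · simp

lemma PathCoord.eq_insert {p : ℕ → V} (h : PathCoord G s (m + 2) p) :
    ∃ s', s = insert (p (m + 1)) s' ∧ Pendant G s' (p (m + 1)) (p m) ∧
      PathCoord G s' (m + 1) p := by
  have hcov : ∀ x, x ∈ s.erase (p (m + 1)) ↔ ∃ i < m + 1, p i = x := by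
    intro x
    rw [mem_erase, h.cover]
    constructor
    · rintro ⟨h1, i, h2, rfl⟩
      have : i ≠ m + 1 := fun e => h1 (by rw [e])
      exact ⟨i, by omega, rfl⟩
    · rintro ⟨i, h1, rfl⟩
      refine ⟨fun e => ?_, i, by omega, rfl⟩
      have := h.inj _ (by omega) _ (by omega) e
      omega
  refine ⟨s.erase (p (m + 1)), (insert_erase (h.mem (by omega))).symm,
    ⟨by simp, (hcov _).2 ⟨m, by omega, rfl⟩, fun x hx => ?_⟩,
    hcov, fun i hi j hj => h.inj i (by omega) j (by omega),
    fun i hi j hj => h.adj i (by omega) j (by omega)⟩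
  obtain ⟨i, hi, rfl⟩ := (hcov x).1 hx
  rw [h.adj _ (by omega) _ (by omega)]
  constructor
  · intro e
    congr 1
    omega
  · intro e
    have := h.inj _ (by omega) _ (by omega) e
    omega

/-- Subtree counts of a path on `m + 1` vertices whose vertices other than `p 0` have weight `1`. -/
lemma PathCoord.wcount_of_eq_one {p : ℕ → V} (h : PathCoord G s (m + 1) p)
    (hf : ∀ i, 0 < i → i ≤ m → f (p i) = 1) :
    wcount G f s {p m} = m + f (p 0) ∧
      wcount G f s ∅ = f (p 0) * (m + 1) + (m + 1).choose 2 := by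
  induction m generalizing s with
  | zero =>
    have : s = {p 0} := by
      ext x
      rw [h.cover]
      simp [eq_comm]
    simp [this, wcount_singleton]
  | succ m ih =>
    obtain ⟨s', rfl, hp, h'⟩ := h.eq_insert
    obtain ⟨ih1, ih2⟩ := ih h' fun i h1 h2 => hf i h1 (by omega)
    have h1 := hp.wcount_insert_singleton (f := f)
    have h2 := wcount_insert (G := G) (f := f) (A := ∅) hp.notMem
    rw [ih1, hf (m + 1) (by omega) le_rfl] at h1
    rw [insert_empty_eq, h1, ih2] at h2
    refine ⟨by rw [h1]; ring, ?_⟩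
    rw [h2, Nat.choose_succ_succ' (m + 1) 1, Nat.choose_one_right]
    ring

/-- The subtree count of a path all of whose inner vertices have weight `1`. -/
lemma PathCoord.wcount_empty {p : ℕ → V} (h : PathCoord G s (m + 2) p)
    (hf : ∀ i, 0 < i → i ≤ m → f (p i) = 1) :
    wcount G f s ∅ = (f (p 0) + f (p (m + 1))) * (m + 1) + f (p 0) * f (p (m + 1)) +
      (m + 1).choose 2 := by
  obtain ⟨s', rfl, hp, h'⟩ := h.eq_insert
  obtain ⟨h3, h4⟩ := h'.wcount_of_eq_one hf
  have h1 := hp.wcount_insert_singleton (f := f)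
  have h2 := wcount_insert (G := G) (f := f) (A := ∅) hp.notMem
  rw [h2, insert_empty_eq, h1, h3, h4]
  ring

lemma two_pow_add_le {x y : ℕ} (h : x + y = k) :
    2 ^ (k / 2) + 2 ^ (k - k / 2) ≤ 2 ^ x + 2 ^ y ∧
      (2 ^ (k / 2) + 2 ^ (k - k / 2) = 2 ^ x + 2 ^ y → x = k / 2 ∨ y = k / 2) := by
  wlog hxy : x ≤ y generalizing x y
  · obtain ⟨h1, h2⟩ := this (x := y) (y := x) (by omega) (by omega)
    rw [add_comm (2 ^ x)]
    exact ⟨h1, fun e => (h2 e).symm⟩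
  by_cases hx : x = k / 2
  · have hy : y = k - k / 2 := by omega
    rw [← hy, ← hx]
    simp
  · obtain ⟨t, ht⟩ : ∃ t, k / 2 = x + (t + 1) := ⟨k / 2 - x - 1, by omega⟩
    obtain ⟨r, hr⟩ : ∃ r, k - k / 2 = x + (r + 1) := ⟨k - k / 2 - x - 1, by omega⟩
    have hy : y = x + (r + 1) + (t + 1) := by omega
    have hlt : 2 ^ (k / 2) + 2 ^ (k - k / 2) < 2 ^ x + 2 ^ y := by
      have h1 : 1 ≤ 2 ^ t := Nat.one_le_two_pow
      have h2 : 1 ≤ 2 ^ r := Nat.one_le_two_pow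
      have h3 : 1 ≤ 2 ^ x := Nat.one_le_two_pow
      rw [hr, ht, hy]
      simp only [pow_add, pow_one]
      have h4 : 2 * 2 ^ t + 2 * 2 ^ r < 1 + 4 * (2 ^ t * 2 ^ r) := by nlinarith
      have h5 := Nat.mul_lt_mul_of_pos_left h4 h3
      nlinarith
    exact ⟨hlt.le, fun e => absurd e hlt.ne⟩

/-- The subgraph induced on `s` is a path whose end vertices have the weights `x` and `y` and whose
inner vertices have weight `0`. -/
def IsEndWeightedPath (G : SimpleGraph V) (s : Finset V) (w : V → ℕ) (x y : ℕ) : Prop :=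
  ∃ p, PathCoord G s #s p ∧ w (p 0) = x ∧ w (p (#s - 1)) = y ∧
    ∀ i, 0 < i → i < #s - 1 → w (p i) = 0

lemma IsEndWeightedPath.symm {w : V → ℕ} {x y : ℕ} (h : IsEndWeightedPath G s w x y) :
    IsEndWeightedPath G s w y x := by
  obtain ⟨p, hp, h1, h2, h3⟩ := h
  refine ⟨_, hp.reverse, by simpa using h2, by simpa using h1, fun i hi hi' => ?_⟩
  exact h3 _ (by omega) (by omega)

/-- The lower bound for trees with vertex weights `2 ^ w x` of total exponent `k`. Removing a leaf
`v` and moving its weight to its neighbour `u` loses the subtree `{v}`, and the subtrees through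
`u` without `v`: the complement of `v`, and at least one of every smaller size. -/
theorem TreeOn.le_wcount (ht : TreeOn G s) {w : V → ℕ} (hw : ∑ x ∈ s, w x = k) :
    (2 ^ (k / 2) + 2 ^ (k - k / 2)) * (#s - 1) + 2 ^ k + (#s - 1).choose 2 ≤
        wcount G (fun x => 2 ^ w x) s ∅ ∧
      ((2 ^ (k / 2) + 2 ^ (k - k / 2)) * (#s - 1) + 2 ^ k + (#s - 1).choose 2 =
        wcount G (fun x => 2 ^ w x) s ∅ → 2 ≤ k → 2 ≤ #s →
        IsEndWeightedPath G s w (k / 2) (k - k / 2)) := by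
  obtain ⟨b, hb⟩ := ht.nonempty
  refine TreeOn.induction (P := fun s => ∀ w : V → ℕ, ∑ x ∈ s, w x = k →
    (2 ^ (k / 2) + 2 ^ (k - k / 2)) * (#s - 1) + 2 ^ k + (#s - 1).choose 2 ≤
        wcount G (fun x => 2 ^ w x) s ∅ ∧
      ((2 ^ (k / 2) + 2 ^ (k - k / 2)) * (#s - 1) + 2 ^ k + (#s - 1).choose 2 =
        wcount G (fun x => 2 ^ w x) s ∅ → 2 ≤ k → 2 ≤ #s →
        IsEndWeightedPath G s w (k / 2) (k - k / 2))) b ?_ ?_ ht hb w hw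
  · intro w hw
    simp only [sum_singleton] at hw
    simp [wcount_singleton, hw]
  · intro s v u _ hp ht _ ih w hw
    have hcard := card_insert_of_notMem hp.notMem
    have hpos := one_le_card_of_mem hp.mem
    rw [sum_insert hp.notMem] at hw
    set w' : V → ℕ := Function.update w u (w u + w v) with hw'
    have hsum' : ∑ x ∈ s, w' x = k := by
      rw [hw', sum_update_of_mem hp.mem, ← hw, ← add_sum_erase s w hp.mem,
        sdiff_singleton_eq_erase]
      ring
    have hfun : (fun x => 2 ^ w' x) =
        Function.update (fun x => 2 ^ w x) u (2 ^ w u * 2 ^ w v) := by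
      ext x
      by_cases hx : x = u
      · simp [hw', hx, pow_add]
      · simp [hw', hx]
    obtain ⟨ih1, ih2⟩ := ih w' hsum'
    have hrec : wcount G (fun x => 2 ^ w x) (insert v s) ∅ =
        wcount G (fun x => 2 ^ w' x) s ∅ + 2 ^ w v + wcount G (fun x => 2 ^ w x) s {u} := by
      have h1 := wcount_insert (G := G) (f := fun x => 2 ^ w x) (A := ∅) hp.notMem
      have h2 := hp.wcount_insert_singleton (f := fun x => 2 ^ w x)
      have h3 := wcount_update (G := G) (f := fun x => 2 ^ w x) (s := s) u (2 ^ w v)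
      rw [← hfun] at h3
      rw [h1, insert_empty_eq, h2]
      linarith
    have hconv := two_pow_add_le hw
    have hchoose : (#s).choose 2 = (#s - 1).choose 2 + (#s - 1) := by
      obtain ⟨q, hq⟩ : ∃ q, #s = q + 1 := ⟨#s - 1, by omega⟩
      rw [hq, Nat.add_sub_cancel, Nat.choose_succ_succ' _ 1, Nat.choose_one_right, add_comm]
    have hmul : ∀ a : ℕ, a * #s = a * (#s - 1) + a := fun a => by
      conv_lhs => rw [← Nat.sub_add_cancel hpos, mul_add, mul_one]
    have hprod : ∏ x ∈ s, 2 ^ w x = 2 ^ ∑ x ∈ s, w x := prod_pow_eq_pow_sum _ _ _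
    rw [hcard, Nat.add_sub_cancel, hrec, hmul, hchoose]
    by_cases hs : 2 ≤ #s
    · have hlow := ht.prod_add_le_wcount_singleton (f := fun x => 2 ^ w x)
        (fun _ => Nat.one_le_two_pow) hp.mem hs
      rw [hprod] at hlow
      have hwu : 1 ≤ 2 ^ w u := Nat.one_le_two_pow
      refine ⟨by omega, fun heq hk _ => ?_⟩
      have hwu0 : w u = 0 := by
        by_contra h0
        have := Nat.one_lt_two_pow h0
        omega
      have hpath := ih2 (by omega) hk hs
      have hwv := hconv.2 (by omega)
      have hw'u : w' u = w v := by simp [hw', hwu0]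
      -- the weight of `v` is positive, so its neighbour is an end of the path
      have key : ∀ x y p, PathCoord G s #s p → w' (p 0) = x → w' (p (#s - 1)) = y →
          (∀ i, 0 < i → i < #s - 1 → w' (p i) = 0) → u = p (#s - 1) →
          IsEndWeightedPath G (insert v s) w x y := by
        intro x y p hp' h1 h2 h3 h4
        have hu : ∀ i, i < #s - 1 → p i ≠ u := fun i hi e => by
          have := hp'.inj i (by omega) (#s - 1) (by omega) (e.trans h4)
          omega
        have hww : ∀ i, i < #s - 1 → w (p i) = w' (p i) := fun i hi => by simp [hw', hu i hi]
        refine ⟨_, hcard ▸ hp'.insert_pendant (by omega) (h4 ▸ hp), ?_, ?_, fun i h5 h6 => ?_⟩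
        · rw [Function.update_of_ne (by omega), hww 0 (by omega), h1]
        · rw [hcard, Nat.add_sub_cancel, Function.update_self, ← hw'u, h4, h2]
        · rw [hcard, Nat.add_sub_cancel] at h6
          rw [Function.update_of_ne (by omega)]
          rcases (show i < #s - 1 ∨ i = #s - 1 by omega) with h7 | h7
          · rw [hww i h7, h3 i h5 h7]
          · rw [h7, ← h4, hwu0]
      obtain ⟨p, hp', h1, h2, h3⟩ := hpath
      obtain ⟨i, hi, hpi⟩ := (hp'.cover u).1 hp.mem
      have hends : i = 0 ∨ i = #s - 1 := by
        by_contra h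
        have := h3 i (by omega) (by omega)
        rw [hpi, hw'u] at this
        omega
      rcases hends with rfl | rfl
      · refine IsEndWeightedPath.symm (key _ _ _
          hp'.reverse (by simpa using h2) (by simpa using h1)
          (fun i h4 h5 => h3 _ (by omega) (by omega)) (by simp [hpi]))
      · exact key _ _ p hp' h1 h2 h3 hpi.symm
    · have hs1 : #s = 1 := by omega
      obtain ⟨x, rfl⟩ := card_eq_one.1 hs1
      obtain rfl := mem_singleton.1 hp.mem
      rw [wcount_singleton _ subset_rfl]
      simp only [sum_singleton] at hw hconv
      refine ⟨by omega, fun heq hk _ => ?_⟩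
      have hwv := hconv.2 (by omega)
      have hpath : PathCoord G {u} 1 fun _ => u :=
        ⟨by simp [eq_comm], by omega, by intro i hi j hj; simp; omega⟩
      have hins := hpath.insert_pendant Nat.one_pos hp
      have hend : IsEndWeightedPath G {v, u} w (w u) (w v) := by
        refine ⟨_, hcard ▸ hins, by simp, by simp [hcard], fun i h1 h2 => ?_⟩
        rw [hcard] at h2
        simp at h2
        omega
      rcases hwv with h | h
      · rw [← h, show k - w v = w u by omega]
        exact hend.symm
      · rw [← h, show k - w u = w v by omega]
        exact hend

/-! ### Removing all leaves -/

lemma Pendant.notMem_leavesIn (ht : TreeOn G s) (hs : 3 ≤ #s) (hv : v ∈ s)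
    (hp : Pendant G (s.erase v) v u) : u ∉ leavesIn G s := by
  have hs' : s = insert v (s.erase v) := (insert_erase hv).symm
  have hc := card_erase_of_mem hv
  generalize s.erase v = s₁ at *
  subst hs'
  have ht' := ht.of_insert hp
  obtain ⟨x, hx, hxu⟩ := exists_mem_ne (show 1 < #s₁ by omega) u
  have := ht'.degIn_pos hp.mem hx hxu
  rw [mem_leavesIn, hp.degIn_insert]
  omega

/-- The subtrees of a tree are its leaves, as singletons, and the sets that arise from a subtree of
the remaining tree by adding some of the leaves adjacent to it. -/
lemma TreeOn.wcount_eq_sdiff (ht : TreeOn G s) (hs : 3 ≤ #s) {L : Finset V}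
    (hL : L ⊆ leavesIn G s) :
    TreeOn G (s \ L) ∧
      wcount G 1 s ∅ = #L + wcount G (fun x => 2 ^ #{y ∈ L | G.Adj y x}) (s \ L) ∅ ∧
      ∑ x ∈ s \ L, #{y ∈ L | G.Adj y x} = #L := by
  induction L using Finset.induction_on with
  | empty =>
    refine ⟨by simpa using ht, ?_, by simp⟩
    simp only [card_empty, zero_add, sdiff_empty]
    exact wcount_congr fun x _ => by simp
  | @insert v L hvL ih =>
    obtain ⟨ht', h1, h2⟩ := ih ((subset_insert _ _).trans hL)
    have hvl := hL (mem_insert_self v L)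
    have hvs := (mem_leavesIn.1 hvl).1
    obtain ⟨u, hu⟩ := exists_pendant_of_mem_leavesIn hvl
    have hul := hu.notMem_leavesIn ht hs hvs
    have huL : u ∉ insert v L := fun h => hul (hL h)
    have hp : Pendant G (s \ insert v L) v u := by
      refine ⟨by simp, mem_sdiff.2 ⟨mem_of_mem_erase hu.mem, huL⟩, fun x hx => hu.adj_iff x ?_⟩
      have hx' := mem_sdiff.1 hx
      exact mem_erase.2 ⟨fun e => hx'.2 (by simp [e]), hx'.1⟩
    have hins : s \ L = insert v (s \ insert v L) := by
      ext x
      simp only [mem_sdiff, mem_insert]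
      by_cases hx : x = v
      · simp [hx, hvs, hvL]
      · simp [hx]
    have hcv : #{y ∈ L | G.Adj y v} = 0 := by
      rw [card_eq_zero, filter_eq_empty_iff]
      intro y hy ha
      have hys := hL (mem_insert_of_mem hy)
      have hye : y ∈ s.erase v := mem_erase.2 ⟨fun e => hvL (e ▸ hy), (mem_leavesIn.1 hys).1⟩
      have : y = u := (hu.adj_iff y hye).1 ha.symm
      exact hul (this ▸ hys)
    have hc : ∀ x ∈ s \ insert v L, #{y ∈ insert v L | G.Adj y x} =
        #{y ∈ L | G.Adj y x} + if x = u then 1 else 0 := by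
      intro x hx
      rw [filter_insert]
      by_cases hxu : x = u
      · rw [if_pos ((hp.adj_iff x hx).2 hxu), if_pos hxu, card_insert_of_notMem (by simp [hvL])]
      · rw [if_neg fun h => hxu ((hp.adj_iff x hx).1 h), if_neg hxu, add_zero]
    rw [hins] at ht' h1 h2
    refine ⟨ht'.of_insert hp, ?_, ?_⟩
    · rw [h1, hp.wcount_insert_empty, hcv, card_insert_of_notMem hvL, pow_zero, ← add_assoc]
      congr 1
      refine wcount_congr fun x hx => ?_
      rw [hc x hx]
      by_cases hxu : x = u
      · rw [hxu, Function.update_self, if_pos rfl, pow_add, pow_one, one_add_one_eq_two]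
      · rw [Function.update_of_ne hxu, if_neg hxu, add_zero]
    · rw [sum_insert hp.notMem, hcv, zero_add] at h2
      rw [sum_congr rfl hc, sum_add_distrib, h2, sum_ite_eq' , if_pos hp.mem,
        card_insert_of_notMem hvL]

end

section

/-! ### The counts on a whole finite graph -/

section Whole

variable {V : Type*} [Fintype V] {G : SimpleGraph V}

lemma numSubtrees_eq_wcount (G : SimpleGraph V) : numSubtrees G = wcount G 1 univ ∅ := by
  have h : {s : Set V | (G.induce s).Connected} =
      (fun S : Finset V => (S : Set V)) ''
        ((univ.powerset.filter fun S => ConnectedOn G S ∧ ∅ ⊆ S : Finset (Finset V)) :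
          Set (Finset V)) := by
    ext s
    simp only [Set.mem_ofPred_eq, Set.mem_image, mem_coe, mem_filter, mem_powerset, subset_univ,
      empty_subset, and_true, true_and]
    constructor
    · exact fun hs => ⟨s.toFinset, by unfold ConnectedOn; rwa [Set.coe_toFinset], by simp⟩
    · rintro ⟨S, hS, rfl⟩
      exact hS
  rw [numSubtrees, h, Set.ncard_image_of_injective _ coe_injective, Set.ncard_coe_finset, wcount]
  simp

lemma leaves_eq_leavesIn (G : SimpleGraph V) : leaves G = leavesIn G univ := by
  ext v
  rw [mem_leavesIn, leaves, mem_filter, degIn,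
    ← SimpleGraph.card_neighborFinset_eq_degree, SimpleGraph.neighborFinset_eq_filter]

lemma treeOn_univ : TreeOn G univ ↔ G.IsTree := by
  unfold TreeOn
  rw [coe_univ]
  exact (SimpleGraph.induceUnivIso G).isTree_iff

lemma isTreeWithLeaves_iff {n k : ℕ} :
    IsTreeWithLeaves n k G ↔ TreeOn G univ ∧ #(univ : Finset V) = n ∧ #(leavesIn G univ) = k := by
  rw [treeOn_univ, card_univ, ← leaves_eq_leavesIn]
  exact ⟨fun h => ⟨h.1, h.2, h.3⟩, fun h => ⟨h.1, h.2.1, h.2.2⟩⟩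

end Whole

lemma numSubtrees_congr {V W : Type*} {G : SimpleGraph V} {H : SimpleGraph W} (φ : G ≃g H) :
    numSubtrees G = numSubtrees H := by
  have key : ∀ s : Set V, (G.induce s).Connected ↔ (H.induce (φ '' s)).Connected := fun s => by
    refine SimpleGraph.Iso.connected_iff ⟨φ.toEquiv.image s, ?_⟩
    rintro ⟨a, ha⟩ ⟨b, hb⟩
    exact φ.map_rel_iff
  unfold numSubtrees
  rw [← Set.ncard_image_of_injective _ φ.injective.image_injective]
  congr 1
  ext t
  simp only [Set.mem_image, Set.mem_ofPred_eq]
  constructor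
  · rintro ⟨s, hs, rfl⟩
    exact (key s).1 hs
  · intro ht
    refine ⟨φ ⁻¹' t, ?_, Set.image_preimage_eq t φ.surjective⟩
    rwa [key, Set.image_preimage_eq t φ.surjective]

/-- A graph whose edges join each vertex except `root` to its parent, of smaller rank, is a tree. -/
lemma isTree_of_parent {V : Type*} [Fintype V] {G : SimpleGraph V} {root : V} {par : V → V}
    (rk : V → ℕ) (hpar : ∀ v, v ≠ root → G.Adj v (par v))
    (hrk : ∀ v, v ≠ root → rk (par v) < rk v)
    (hadj : ∀ x y, G.Adj x y → (x ≠ root ∧ par x = y) ∨ (y ≠ root ∧ par y = x)) : G.IsTree := by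
  have hreach : ∀ n v, rk v = n → G.Reachable root v := by
    intro n
    induction n using Nat.strong_induction_on with
    | _ n ih =>
      rintro v rfl
      by_cases hv : v = root
      · rw [hv]
      · exact (ih _ (hrk v hv) _ rfl).trans (hpar v hv).symm.reachable
  have hconn : G.Connected := by
    rw [SimpleGraph.connected_iff_exists_forall_reachable]
    exact ⟨root, fun v => hreach _ v rfl⟩
  refine SimpleGraph.isTree_iff_connected_and_card.2
    ⟨hconn, le_antisymm ?_ hconn.card_vert_le_card_edgeSet_add_one⟩
  have hsub : G.edgeSet ⊆ (((univ.erase root).image fun v => s(v, par v) : Finset (Sym2 V)) :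
      Set (Sym2 V)) := by
    intro e he
    induction e using Sym2.ind with
    | _ x y =>
      rcases hadj x y he with ⟨h1, h2⟩ | ⟨h1, h2⟩
      · simp only [coe_image, Set.mem_image, mem_coe, mem_erase, mem_univ, and_true]
        exact ⟨x, h1, by rw [h2]⟩
      · simp only [coe_image, Set.mem_image, mem_coe, mem_erase, mem_univ, and_true]
        exact ⟨y, h1, by rw [h2, Sym2.eq_swap]⟩
  have h1 := Set.ncard_le_ncard hsub (finite_toSet _)
  rw [Set.ncard_coe_finset] at h1
  have h2 : #((univ.erase root).image fun v => s(v, par v)) ≤ Fintype.card V - 1 := by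
    refine card_image_le.trans ?_
    rw [card_erase_of_mem (mem_univ _), card_univ]
  have h3 : 0 < Fintype.card V := Fintype.card_pos_iff.2 ⟨root⟩
  rw [Nat.card_coe_set_eq, Nat.card_eq_fintype_card]
  omega

lemma degIn_eq_one_of {V : Type*} {G : SimpleGraph V} {s : Finset V} {v u : V} (hu : u ∈ s)
    (h : ∀ x ∈ s, G.Adj v x ↔ x = u) : degIn G s v = 1 := by
  refine card_eq_one.2 ⟨u, ?_⟩
  ext x
  simp only [mem_filter, mem_singleton]
  constructor
  · exact fun hx => (h x hx.1).1 hx.2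
  · rintro rfl
    exact ⟨hu, (h x hu).2 rfl⟩

lemma degIn_ne_one_of {V : Type*} {G : SimpleGraph V} {s : Finset V} {v x y : V} (hx : x ∈ s)
    (hy : y ∈ s) (hvx : G.Adj v x) (hvy : G.Adj v y) (hxy : x ≠ y) : degIn G s v ≠ 1 := by
  have : 1 < degIn G s v :=
    one_lt_card.2 ⟨x, mem_filter.2 ⟨hx, hvx⟩, y, mem_filter.2 ⟨hy, hvy⟩, hxy⟩
  omega

/-! ### The spider -/

variable {k : ℕ} {l : Fin k → ℕ}

lemma spider_adj_none_some {y : Σ i : Fin k, Fin (l i)} :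
    (spider l).Adj none (some y) ↔ y.2.val = 0 := by
  simp [spider, SimpleGraph.fromRel_adj, spiderEdge]

lemma spider_adj_some_some {x y : Σ i : Fin k, Fin (l i)} :
    (spider l).Adj (some x) (some y) ↔
      x.1 = y.1 ∧ (x.2.val + 1 = y.2.val ∨ y.2.val + 1 = x.2.val) := by
  simp only [spider, SimpleGraph.fromRel_adj, spiderEdge, ne_eq, Option.some.injEq]
  constructor
  · rintro ⟨-, h | h⟩
    · exact ⟨h.1, Or.inl h.2⟩
    · exact ⟨h.1.symm, Or.inr h.2⟩
  · rintro ⟨h1, h2⟩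
    refine ⟨?_, h2.imp (fun h => ⟨h1, h⟩) fun h => ⟨h1.symm, h⟩⟩
    rintro rfl
    omega

lemma isSpiderOn_spider (l : Fin k → ℕ) : IsSpiderOn (spider l) univ none l := by
  have hval : ∀ (i : Fin k) (j : ℕ) (h1 : 1 ≤ j) (h2 : j ≤ l i),
      (if h : 1 ≤ j ∧ j ≤ l i then some ⟨i, ⟨j - 1, by omega⟩⟩ else none : SpiderVertex l) =
        some ⟨i, ⟨j - 1, by omega⟩⟩ := fun i j h1 h2 => dif_pos ⟨h1, h2⟩
  refine ⟨fun i j => if h : 1 ≤ j ∧ j ≤ l i then some ⟨i, ⟨j - 1, by omega⟩⟩ else none,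
    ?_, ?_, ?_, ?_, ?_⟩
  · rintro (_ | ⟨i, j⟩)
    · simp
    · simp only [mem_univ, true_iff]
      refine Or.inr ⟨i, j + 1, by omega, j.2, ?_⟩
      rw [hval i (j + 1) (by omega) j.2]
      simp
  · intro i j h1 h2
    rw [hval i j h1 h2]
    simp
  · intro i j i' j' h1 h2 h3 h4
    rw [hval i j h1 h2, hval i' j' h3 h4, Option.some.injEq]
    intro h
    have hi : i = i' := congrArg Sigma.fst h
    subst hi
    have hj := congrArg Fin.val (eq_of_heq (Sigma.mk.inj h).2)
    simp only at hj
    exact ⟨rfl, by omega⟩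
  · intro i j h1 h2
    rw [hval i j h1 h2, SimpleGraph.adj_comm, spider_adj_none_some]
    simp only
    omega
  · intro i j i' j' h1 h2 h3 h4
    rw [hval i j h1 h2, hval i' j' h3 h4, spider_adj_some_some]
    simp only
    refine and_congr_right fun _ => ?_
    omega

lemma IsSpiderOn.nonempty_iso {V : Type*} [Fintype V] {G : SimpleGraph V} {b : V}
    (h : IsSpiderOn G univ b l) : Nonempty (G ≃g spider l) := by
  obtain ⟨f, hf⟩ := h
  let F : SpiderVertex l → V := fun x => x.elim b fun y => f y.1 (y.2 + 1)
  have hF0 : F none = b := rfl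
  have hF1 : ∀ y, F (some y) = f y.1 (y.2 + 1) := fun y => rfl
  have hbij : Function.Bijective F := by
    constructor
    · rintro (_ | ⟨i, j⟩) (_ | ⟨i', j'⟩) h
      · rfl
      · exact absurd h.symm (hf.ne_center _ _ (by omega) j'.2)
      · exact absurd h (hf.ne_center _ _ (by omega) j.2)
      · obtain ⟨h1, h2⟩ := hf.inj _ _ _ _ (by omega) j.2 (by omega) j'.2 h
        subst h1
        have : j = j' := Fin.ext (by omega)
        rw [this]
    · intro x
      rcases (hf.cover x).1 (mem_univ x) with rfl | ⟨i, j, h1, h2, rfl⟩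
      · exact ⟨none, rfl⟩
      · refine ⟨some ⟨i, ⟨j - 1, by omega⟩⟩, ?_⟩
        rw [hF1]
        simp only
        congr 1
        omega
  refine ⟨RelIso.symm ⟨Equiv.ofBijective F hbij, ?_⟩⟩
  rintro (_ | ⟨i, j⟩) (_ | ⟨i', j'⟩)
  · simp
  · rw [Equiv.ofBijective_apply, Equiv.ofBijective_apply, hF0, hF1, G.adj_comm,
      hf.adj_center _ _ (by omega) j'.2, spider_adj_none_some]
    simp
  · rw [Equiv.ofBijective_apply, Equiv.ofBijective_apply, hF0, hF1,
      hf.adj_center _ _ (by omega) j.2, SimpleGraph.adj_comm, spider_adj_none_some]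
    simp
  · rw [Equiv.ofBijective_apply, Equiv.ofBijective_apply, hF1, hF1,
      hf.adj _ _ _ _ (by omega) j.2 (by omega) j'.2, spider_adj_some_some]
    simp only
    refine and_congr_right fun _ => ?_
    omega

lemma spider_isTree (l : Fin k → ℕ) : (spider l).IsTree := by
  refine isTree_of_parent (root := none)
    (par := fun x => x.elim none fun y =>
      if y.2.val = 0 then none else some ⟨y.1, ⟨y.2.val - 1, by omega⟩⟩)
    (fun x => x.elim 0 fun y => y.2.val + 1) ?_ ?_ ?_
  · rintro (_ | y) hy
    · exact absurd rfl hy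
    · simp only [Option.elim_some]
      split_ifs with h
      · exact (spider_adj_none_some.2 h).symm
      · rw [spider_adj_some_some]
        refine ⟨rfl, Or.inr ?_⟩
        simp only
        omega
  · rintro (_ | y) hy
    · exact absurd rfl hy
    · simp only [Option.elim_some]
      split_ifs with h
      · simp
      · simp only [Option.elim_some]
        omega
  · rintro (_ | ⟨i, j⟩) (_ | ⟨i', j'⟩) h
    · exact absurd h (SimpleGraph.irrefl _)
    · exact Or.inr ⟨by simp, by simpa using spider_adj_none_some.1 h⟩
    · exact Or.inl ⟨by simp, by simpa using spider_adj_none_some.1 h.symm⟩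
    · obtain ⟨h1, h2⟩ := spider_adj_some_some.1 h
      simp only at h1 h2
      subst h1
      rcases h2 with h2 | h2
      · refine Or.inr ⟨by simp, ?_⟩
        simp only [Option.elim_some]
        rw [if_neg (by omega)]
        congr 3
        omega
      · refine Or.inl ⟨by simp, ?_⟩
        simp only [Option.elim_some]
        rw [if_neg (by omega)]
        congr 3
        omega

/-- The leaves of a spider are the ends of its legs. -/
lemma SpiderCoord.card_leavesIn {V : Type*} {G : SimpleGraph V} {s : Finset V} {b : V}
    {f : Fin k → ℕ → V} (hf : SpiderCoord G s b l f) (hk : 2 ≤ k) (hpos : ∀ i, 1 ≤ l i) :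
    #(leavesIn G s) = k := by
  have hmem : ∀ i j, 1 ≤ j → j ≤ l i → f i j ∈ s := fun i j h1 h2 =>
    (hf.cover _).2 (Or.inr ⟨i, j, h1, h2, rfl⟩)
  have hb : b ∈ s := (hf.cover b).2 (Or.inl rfl)
  have hlv : leavesIn G s = univ.image fun i => f i (l i) := by
    ext x
    simp only [mem_leavesIn, mem_image, mem_univ, true_and]
    constructor
    · rintro ⟨hx, hdeg⟩
      rcases (hf.cover x).1 hx with rfl | ⟨i, j, h1, h2, rfl⟩
      · -- the center has at least two neighbours
        refine absurd hdeg (degIn_ne_one_of (hmem ⟨0, by omega⟩ 1 le_rfl (hpos _))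
          (hmem ⟨1, by omega⟩ 1 le_rfl (hpos _)) ((hf.adj_center _ _ le_rfl (hpos _)).2 rfl).symm
          ((hf.adj_center _ _ le_rfl (hpos _)).2 rfl).symm fun e => ?_)
        have := (hf.inj _ _ _ _ le_rfl (hpos _) le_rfl (hpos _) e).1
        simp at this
      · by_cases hj : j = l i
        · exact ⟨i, by rw [hj]⟩
        have hnext : G.Adj (f i j) (f i (j + 1)) :=
          (hf.adj _ _ _ _ h1 h2 (by omega) (by omega)).2 ⟨rfl, Or.inl rfl⟩
        have hmem' := hmem i (j + 1) (by omega) (by omega)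
        by_cases hj1 : j = 1
        · exact absurd hdeg (degIn_ne_one_of hmem' hb hnext ((hf.adj_center _ _ h1 h2).2 hj1)
            (hf.ne_center _ _ (by omega) (by omega)))
        · refine absurd hdeg (degIn_ne_one_of hmem' (hmem i (j - 1) (by omega) (by omega)) hnext
            ((hf.adj _ _ _ _ h1 h2 (by omega) (by omega)).2 ⟨rfl, Or.inr (by omega)⟩) fun e => ?_)
          have := (hf.inj _ _ _ _ (by omega) (by omega) (by omega) (by omega) e).2
          omega
    · rintro ⟨i, rfl⟩
      refine ⟨hmem i _ (hpos i) le_rfl, ?_⟩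
      by_cases hl : l i = 1
      · refine degIn_eq_one_of hb fun x hx => ?_
        rcases (hf.cover x).1 hx with rfl | ⟨i', j', h1, h2, rfl⟩
        · rw [hf.adj_center i _ (hpos i) le_rfl]
          simp [hl]
        · rw [hf.adj _ _ _ _ (hpos i) le_rfl h1 h2]
          constructor
          · rintro ⟨rfl, h⟩
            omega
          · exact fun e => absurd e (hf.ne_center _ _ h1 h2)
      · have hl' := hpos i
        refine degIn_eq_one_of (hmem i (l i - 1) (by omega) (by omega)) fun x hx => ?_
        rcases (hf.cover x).1 hx with rfl | ⟨i', j', h1, h2, rfl⟩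
        · rw [hf.adj_center i _ (hpos i) le_rfl]
          exact ⟨fun e => absurd e hl,
            fun e => absurd e.symm (hf.ne_center _ _ (by omega) (by omega))⟩
        · rw [hf.adj _ _ _ _ (hpos i) le_rfl h1 h2]
          constructor
          · rintro ⟨rfl, h⟩
            congr 1
            omega
          · intro e
            obtain ⟨rfl, h⟩ := hf.inj _ _ _ _ h1 h2 (by omega) (by omega) e
            exact ⟨rfl, by omega⟩
  rw [hlv, card_image_of_injective, card_univ, Fintype.card_fin]
  exact fun i j e => (hf.inj _ _ _ _ (hpos i) le_rfl (hpos j) le_rfl e).1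

end

section

/-! ### The double broom -/

variable {m a b : ℕ}

lemma doubleBroom_adj_inl_inl {x y : Fin m} :
    (doubleBroom m a b).Adj (.inl x) (.inl y) ↔ x.val + 1 = y.val ∨ y.val + 1 = x.val := by
  simp only [doubleBroom, SimpleGraph.fromRel_adj, broomEdge, ne_eq, Sum.inl.injEq]
  exact ⟨And.right, fun h => ⟨by rintro rfl; omega, h⟩⟩

lemma doubleBroom_adj_inl {x : Fin m} {y : Fin a} :
    (doubleBroom m a b).Adj (.inr (.inl y)) (.inl x) ↔ x.val = 0 := by
  simp [doubleBroom, SimpleGraph.fromRel_adj, broomEdge]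

lemma doubleBroom_adj_inr {x : Fin m} {y : Fin b} :
    (doubleBroom m a b).Adj (.inr (.inr y)) (.inl x) ↔ x.val + 1 = m := by
  simp [doubleBroom, SimpleGraph.fromRel_adj, broomEdge]

lemma doubleBroom_not_adj_inr_inr {x y : Fin a ⊕ Fin b} :
    ¬ (doubleBroom m a b).Adj (.inr x) (.inr y) := by
  simp [doubleBroom, SimpleGraph.fromRel_adj, broomEdge]

lemma doubleBroom_isTree (hm : 1 ≤ m) : (doubleBroom m a b).IsTree := by
  refine isTree_of_parent (root := .inl ⟨0, hm⟩)
    (par := Sum.elim (fun x => .inl ⟨x.val - 1, by omega⟩)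
      (Sum.elim (fun _ => .inl ⟨0, hm⟩) fun _ => .inl ⟨m - 1, by omega⟩))
    (Sum.elim (fun x => x.val) fun _ => m) ?_ ?_ ?_
  · rintro (x | y | y) hx
    · have hx0 : x.val ≠ 0 := fun e => hx (congrArg Sum.inl (Fin.ext e))
      simp only [Sum.elim_inl]
      rw [doubleBroom_adj_inl_inl]
      simp only
      omega
    · simp only [Sum.elim_inr, Sum.elim_inl]
      rw [doubleBroom_adj_inl]
    · simp only [Sum.elim_inr]
      rw [doubleBroom_adj_inr]
      simp only
      omega
  · rintro (x | y | y) hx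
    · have hx0 : x.val ≠ 0 := fun e => hx (congrArg Sum.inl (Fin.ext e))
      simp only [Sum.elim_inl]
      omega
    · simp only [Sum.elim_inr, Sum.elim_inl]
      omega
    · simp only [Sum.elim_inr, Sum.elim_inl]
      omega
  · have hpend : ∀ (x : Fin m) (y : Fin a ⊕ Fin b), (doubleBroom m a b).Adj (.inr y) (.inl x) →
        Sum.elim (fun _ => Sum.inl ⟨0, hm⟩) (fun _ => .inl ⟨m - 1, by omega⟩) y =
          (Sum.inl x : Fin m ⊕ (Fin a ⊕ Fin b)) := by
      rintro x (y | y) h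
      · have := doubleBroom_adj_inl.1 h
        exact congrArg Sum.inl (Fin.ext this.symm)
      · have := doubleBroom_adj_inr.1 h
        exact congrArg Sum.inl (Fin.ext (by simp only; omega))
    rintro (x | x) (y | y) h
    · rcases doubleBroom_adj_inl_inl.1 h with h | h
      · refine Or.inr ⟨fun e => ?_, congrArg Sum.inl (Fin.ext (by simp only; omega))⟩
        have := congrArg Fin.val (Sum.inl.inj e)
        simp only at this
        omega
      · refine Or.inl ⟨fun e => ?_, congrArg Sum.inl (Fin.ext (by simp only; omega))⟩
        have := congrArg Fin.val (Sum.inl.inj e)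
        simp only at this
        omega
    · exact Or.inr ⟨by simp, hpend x y h.symm⟩
    · exact Or.inl ⟨by simp, hpend y x h⟩
    · exact absurd h doubleBroom_not_adj_inr_inr

/-- Coordinates of a double broom on a graph: the vertices outside `L₀ ∪ L₁` form the path `p`, the
vertices in `L₀` are pendant vertices at its first vertex, those in `L₁` at its last vertex. -/
structure BroomCoord {V : Type*} [Fintype V] (G : SimpleGraph V) (m : ℕ) (p : ℕ → V)
    (L₀ L₁ : Finset V) : Prop where
  pos : 0 < m
  disj : Disjoint L₀ L₁
  path : PathCoord G (univ \ (L₀ ∪ L₁)) m p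
  adj_left : ∀ v ∈ L₀, ∀ x, G.Adj v x ↔ x = p 0
  adj_right : ∀ v ∈ L₁, ∀ x, G.Adj v x ↔ x = p (m - 1)

lemma BroomCoord.nonempty_iso {V : Type*} [Fintype V] {G : SimpleGraph V} {p : ℕ → V}
    {L₀ L₁ : Finset V} (h : BroomCoord G m p L₀ L₁) (h₀ : #L₀ = a) (h₁ : #L₁ = b) :
    Nonempty (G ≃g doubleBroom m a b) := by
  have hm := h.pos
  let e₀ := (L₀.equivFinOfCardEq h₀).symm
  let e₁ := (L₁.equivFinOfCardEq h₁).symm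
  let F : Fin m ⊕ (Fin a ⊕ Fin b) → V :=
    Sum.elim (fun x => p x) (Sum.elim (fun y => e₀ y) fun y => e₁ y)
  have hpmem : ∀ i < m, p i ∉ L₀ ∧ p i ∉ L₁ := fun i hi => by
    simpa [not_or] using h.path.mem hi
  have hbij : Function.Bijective F := by
    constructor
    · rintro (x | x | x) (y | y | y) hxy
      · exact congrArg Sum.inl (Fin.ext (h.path.inj _ x.2 _ y.2 hxy))
      · have hxy : p x = e₀ y := hxy
        exact absurd (hxy ▸ (e₀ y).2) (hpmem x x.2).1
      · have hxy : p x = e₁ y := hxy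
        exact absurd (hxy ▸ (e₁ y).2) (hpmem x x.2).2
      · have hxy : (e₀ x : V) = p y := hxy
        exact absurd (hxy ▸ (e₀ x).2) (hpmem y y.2).1
      · have hxy : (e₀ x : V) = e₀ y := hxy
        rw [e₀.injective (Subtype.ext hxy)]
      · have hxy : (e₀ x : V) = e₁ y := hxy
        exact absurd (e₁ y).2 (disjoint_left.1 h.disj (hxy ▸ (e₀ x).2))
      · have hxy : (e₁ x : V) = p y := hxy
        exact absurd (hxy ▸ (e₁ x).2) (hpmem y y.2).2
      · have hxy : (e₁ x : V) = e₀ y := hxy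
        exact absurd (hxy ▸ (e₁ x).2) (disjoint_left.1 h.disj (e₀ y).2)
      · have hxy : (e₁ x : V) = e₁ y := hxy
        rw [e₁.injective (Subtype.ext hxy)]
    · intro x
      by_cases hx₀ : x ∈ L₀
      · exact ⟨.inr (.inl (e₀.symm ⟨x, hx₀⟩)), by simp [F]⟩
      by_cases hx₁ : x ∈ L₁
      · exact ⟨.inr (.inr (e₁.symm ⟨x, hx₁⟩)), by simp [F]⟩
      obtain ⟨i, hi, rfl⟩ := (h.path.cover x).1 (by simp [hx₀, hx₁])
      exact ⟨.inl ⟨i, hi⟩, rfl⟩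
  have hp0 : ∀ x : Fin m, p x = p 0 ↔ x.val = 0 := fun x =>
    ⟨h.path.inj _ x.2 _ hm, fun e => by rw [e]⟩
  have hpl : ∀ x : Fin m, p x = p (m - 1) ↔ x.val + 1 = m := fun x =>
    ⟨fun e => by have := h.path.inj _ x.2 _ (by omega) e; omega, fun e => by congr 1; omega⟩
  have hne₀ : ∀ y, (e₀ y : V) ≠ p 0 ∧ (e₀ y : V) ≠ p (m - 1) := fun y =>
    ⟨fun e => (hpmem 0 hm).1 (e ▸ (e₀ y).2), fun e => (hpmem (m - 1) (by omega)).1 (e ▸ (e₀ y).2)⟩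
  have hne₁ : ∀ y, (e₁ y : V) ≠ p 0 ∧ (e₁ y : V) ≠ p (m - 1) := fun y =>
    ⟨fun e => (hpmem 0 hm).2 (e ▸ (e₁ y).2), fun e => (hpmem (m - 1) (by omega)).2 (e ▸ (e₁ y).2)⟩
  have hadj : ∀ x y, G.Adj (F x) (F y) ↔ (doubleBroom m a b).Adj x y := by
    have h01 : ∀ (x : Fin m) (y : Fin a), G.Adj (e₀ y) (p x) ↔
        (doubleBroom m a b).Adj (.inr (.inl y)) (.inl x) := fun x y => by
      rw [h.adj_left _ (e₀ y).2, doubleBroom_adj_inl, hp0]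
    have h02 : ∀ (x : Fin m) (y : Fin b), G.Adj (e₁ y) (p x) ↔
        (doubleBroom m a b).Adj (.inr (.inr y)) (.inl x) := fun x y => by
      rw [h.adj_right _ (e₁ y).2, doubleBroom_adj_inr, hpl]
    rintro (x | x | x) (y | y | y)
    · exact (h.path.adj _ x.2 _ y.2).trans doubleBroom_adj_inl_inl.symm
    · rw [G.adj_comm, SimpleGraph.adj_comm _ (Sum.inl x)]
      exact h01 x y
    · rw [G.adj_comm, SimpleGraph.adj_comm _ (Sum.inl x)]
      exact h02 x y
    · exact h01 y x
    · exact iff_of_false (fun ha => (hne₀ y).1 ((h.adj_left _ (e₀ x).2 _).1 ha))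
        doubleBroom_not_adj_inr_inr
    · exact iff_of_false (fun ha => (hne₁ y).1 ((h.adj_left _ (e₀ x).2 _).1 ha))
        doubleBroom_not_adj_inr_inr
    · exact h02 y x
    · exact iff_of_false (fun ha => (hne₀ y).2 ((h.adj_right _ (e₁ x).2 _).1 ha))
        doubleBroom_not_adj_inr_inr
    · exact iff_of_false (fun ha => (hne₁ y).2 ((h.adj_right _ (e₁ x).2 _).1 ha))
        doubleBroom_not_adj_inr_inr
  exact ⟨RelIso.symm ⟨Equiv.ofBijective F hbij, fun {x y} => hadj x y⟩⟩

lemma exists_broomCoord_doubleBroom (hm : 1 ≤ m) :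
    ∃ p L₀ L₁, BroomCoord (doubleBroom m a b) m p L₀ L₁ ∧ #L₀ = a ∧ #L₁ = b := by
  have hval : ∀ i (hi : i < m), (if h : i < m then .inl ⟨i, h⟩ else .inl ⟨0, hm⟩ :
      Fin m ⊕ (Fin a ⊕ Fin b)) = .inl ⟨i, hi⟩ := fun i hi => dif_pos hi
  refine ⟨fun i => if h : i < m then .inl ⟨i, h⟩ else .inl ⟨0, hm⟩,
    univ.image fun y => .inr (.inl y), univ.image fun y => .inr (.inr y),
    ⟨hm, ?_, ⟨?_, ?_, ?_⟩, ?_, ?_⟩, ?_, ?_⟩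
  · rw [disjoint_left]
    simp
  · rintro (x | x | x)
    · simp only [mem_sdiff, mem_univ, mem_union, mem_image, true_and, reduceCtorEq, exists_false,
        or_self, not_false_eq_true, true_iff]
      exact ⟨x, x.2, hval x x.2⟩
    · refine iff_of_false (by simp) ?_
      rintro ⟨i, hi, h⟩
      rw [hval i hi] at h
      cases h
    · refine iff_of_false (by simp) ?_
      rintro ⟨i, hi, h⟩
      rw [hval i hi] at h
      cases h
  · intro i hi j hj h
    simp only [hval i hi, hval j hj] at h
    simpa using h
  · intro i hi j hj
    simp only [hval i hi, hval j hj]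
    exact doubleBroom_adj_inl_inl
  · intro v hv x
    obtain ⟨y, -, rfl⟩ := mem_image.1 hv
    simp only [hval 0 hm]
    rcases x with x | x
    · rw [doubleBroom_adj_inl, Sum.inl.injEq, Fin.ext_iff]
    · exact iff_of_false doubleBroom_not_adj_inr_inr (by simp)
  · intro v hv x
    obtain ⟨y, -, rfl⟩ := mem_image.1 hv
    simp only [hval (m - 1) (by omega)]
    rcases x with x | x
    · rw [doubleBroom_adj_inr, Sum.inl.injEq, Fin.ext_iff]
      simp only
      omega
    · exact iff_of_false doubleBroom_not_adj_inr_inr (by simp)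
  · rw [card_image_of_injective, card_univ, Fintype.card_fin]
    intro x y h
    simpa using h
  · rw [card_image_of_injective, card_univ, Fintype.card_fin]
    intro x y h
    simpa using h

variable {V : Type*} [Fintype V] {G : SimpleGraph V} {p : ℕ → V} {L₀ L₁ : Finset V}

lemma BroomCoord.leavesIn_eq (h : BroomCoord G m p L₀ L₁) (h₀ : L₀.Nonempty) (h₁ : L₁.Nonempty) :
    leavesIn G univ = L₀ ∪ L₁ := by
  have hm := h.pos
  ext x
  rw [mem_leavesIn, mem_union]
  constructor
  · rintro ⟨-, hdeg⟩
    by_contra hx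
    obtain ⟨i, hi, rfl⟩ := (h.path.cover x).1 (by simpa using hx)
    obtain ⟨v₀, hv₀⟩ := h₀
    obtain ⟨v₁, hv₁⟩ := h₁
    have hne : ∀ j < m, p j ∉ L₀ ∧ p j ∉ L₁ := fun j hj => by
      simpa [not_or] using h.path.mem hj
    -- the neighbours of `p i` in the two directions
    obtain ⟨y, hy, hy'⟩ : ∃ y, G.Adj (p i) y ∧ (y ∈ L₀ ∨ ∃ j, j < m ∧ j + 1 = i ∧ y = p j) := by
      by_cases hi0 : i = 0
      · exact ⟨v₀, ((h.adj_left _ hv₀ _).2 (by rw [hi0])).symm, Or.inl hv₀⟩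
      · exact ⟨p (i - 1), (h.path.adj _ hi _ (by omega)).2 (by omega),
          Or.inr ⟨i - 1, by omega, by omega, rfl⟩⟩
    obtain ⟨z, hz, hz'⟩ : ∃ z, G.Adj (p i) z ∧ (z ∈ L₁ ∨ ∃ j, j < m ∧ i + 1 = j ∧ z = p j) := by
      by_cases hil : i = m - 1
      · exact ⟨v₁, ((h.adj_right _ hv₁ _).2 (by rw [hil])).symm, Or.inl hv₁⟩
      · exact ⟨p (i + 1), (h.path.adj _ hi _ (by omega)).2 (by omega),
          Or.inr ⟨i + 1, by omega, by omega, rfl⟩⟩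
    refine degIn_ne_one_of (mem_univ y) (mem_univ z) hy hz ?_ hdeg
    rintro rfl
    rcases hy' with hy' | ⟨j, hj, hji, rfl⟩ <;> rcases hz' with hz' | ⟨j', hj', hji', e⟩
    · exact disjoint_left.1 h.disj hy' hz'
    · exact (hne j' hj').1 (e ▸ hy')
    · exact (hne j hj).2 hz'
    · have := h.path.inj _ hj _ hj' e
      omega
  · rintro (hx | hx)
    · exact ⟨mem_univ x, degIn_eq_one_of (mem_univ _) fun y _ => h.adj_left x hx y⟩
    · exact ⟨mem_univ x, degIn_eq_one_of (mem_univ _) fun y _ => h.adj_right x hx y⟩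

lemma BroomCoord.card_leavesIn (h : BroomCoord G m p L₀ L₁) (h₀ : L₀.Nonempty)
    (h₁ : L₁.Nonempty) : #(leavesIn G univ) = #L₀ + #L₁ := by
  rw [h.leavesIn_eq h₀ h₁, card_union_of_disjoint h.disj]

lemma BroomCoord.card_univ (h : BroomCoord G m p L₀ L₁) :
    #(univ : Finset V) = m + (#L₀ + #L₁) := by
  have h1 := h.path.card_eq
  rw [← card_union_of_disjoint h.disj]
  have h2 := card_sdiff_add_card_eq_card (subset_univ (L₀ ∪ L₁))
  omega

lemma BroomCoord.wcount_eq (h : BroomCoord G m p L₀ L₁) (ht : TreeOn G univ)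
    (h₀ : L₀.Nonempty) (h₁ : L₁.Nonempty) :
    wcount G 1 univ ∅ = (2 ^ #L₀ + 2 ^ #L₁) * (m - 1) + 2 ^ (#L₀ + #L₁) + (#L₀ + #L₁) +
      (m - 1).choose 2 := by
  have hm := h.pos
  have hlv := h.leavesIn_eq h₀ h₁
  have hc₀ := card_pos.2 h₀
  have hc₁ := card_pos.2 h₁
  have hcard := h.card_univ
  have h1 := (ht.wcount_eq_sdiff (by omega) hlv.ge).2.1
  rw [card_union_of_disjoint h.disj] at h1
  have hw : ∀ x, #{y ∈ L₀ ∪ L₁ | G.Adj y x} =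
      (if x = p 0 then #L₀ else 0) + if x = p (m - 1) then #L₁ else 0 := by
    intro x
    rw [filter_union, card_union_of_disjoint (disjoint_filter_filter h.disj),
      filter_congr fun y hy => h.adj_left y hy x, filter_congr fun y hy => h.adj_right y hy x,
      filter_const, filter_const]
    split_ifs <;> simp
  simp only [hw] at h1
  rw [h1]
  rcases (show m = 1 ∨ ∃ r, m = r + 2 from by
    rcases m with _ | _ | r
    · omega
    · exact Or.inl rfl
    · exact Or.inr ⟨r, rfl⟩) with rfl | ⟨r, rfl⟩
  · have := (h.path.wcount_of_eq_one (m := 0) (f := fun x => 2 ^ ((if x = p 0 then #L₀ else 0) +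
      if x = p (1 - 1) then #L₁ else 0)) (by omega)).2
    rw [this]
    simp
    ring
  · have hne : ∀ i < r + 2, i ≠ 0 → p i ≠ p 0 := fun i hi h0 e =>
      h0 (h.path.inj _ hi _ (by omega) e)
    have hne' : ∀ i < r + 2, i ≠ r + 1 → p i ≠ p (r + 1) := fun i hi h0 e =>
      h0 (h.path.inj _ hi _ (by omega) e)
    have := h.path.wcount_empty (f := fun x => 2 ^ ((if x = p 0 then #L₀ else 0) +
      if x = p (r + 2 - 1) then #L₁ else 0)) (fun i h2 h3 => by
        simp [hne i (by omega) (by omega), hne' i (by omega) (by omega)])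
    rw [this]
    simp [hne (r + 1) (by omega) (by omega), hne' 0 (by omega) (by omega)]
    ring

/-- The lower bound for the number of subtrees; a tree attaining it is a double broom. -/
lemma TreeOn.le_wcount_univ {k : ℕ} (ht : TreeOn G univ) (hk : 2 ≤ k)
    (hs : 3 ≤ #(univ : Finset V)) (hlv : #(leavesIn G univ) = k)
    (hlt : k < #(univ : Finset V)) :
    (2 ^ (k / 2) + 2 ^ (k - k / 2)) * (#(univ : Finset V) - k - 1) + 2 ^ k + k +
        (#(univ : Finset V) - k - 1).choose 2 ≤ wcount G 1 univ ∅ ∧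
      ((2 ^ (k / 2) + 2 ^ (k - k / 2)) * (#(univ : Finset V) - k - 1) + 2 ^ k + k +
        (#(univ : Finset V) - k - 1).choose 2 = wcount G 1 univ ∅ →
        Nonempty (G ≃g doubleBroom (#(univ : Finset V) - k) (k / 2) (k - k / 2))) := by
  set L := leavesIn G univ with hL
  obtain ⟨htC, hcount, hsum⟩ := ht.wcount_eq_sdiff hs (subset_refl L)
  have hC : #(univ \ L) = #(univ : Finset V) - k := by
    rw [card_sdiff_of_subset (subset_univ L), hlv]
  obtain ⟨hle, heq⟩ := htC.le_wcount (hsum.trans hlv)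
  rw [hC] at hle heq
  rw [hcount, hlv]
  refine ⟨by omega, fun he => ?_⟩
  have he' := heq (by omega) hk
  -- each leaf has its only neighbour outside `L`
  have hleaf : ∀ v ∈ L, ∀ x, G.Adj v x → ∀ y, G.Adj v y ↔ y = x := by
    intro v hv x hx
    obtain ⟨u, hu⟩ := exists_pendant_of_mem_leavesIn hv
    have hu' : ∀ y, G.Adj v y ↔ y = u := fun y => by
      by_cases hy : y = v
      · rw [hy]
        exact iff_of_false (G.irrefl) hu.ne
      · exact hu.adj_iff y (by simp [hy])
    rw [(hu' x).1 hx]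
    exact hu'
  by_cases h2 : 2 ≤ #(univ : Finset V) - k
  · obtain ⟨p, hp, hp0, hp1, hp2⟩ := he' h2
    rw [hC] at hp hp1 hp2
    set m := #(univ : Finset V) - k with hm
    set L₀ : Finset V := {y ∈ L | G.Adj y (p 0)} with hL₀
    set L₁ : Finset V := {y ∈ L | G.Adj y (p (m - 1))} with hL₁
    have hp0 : #L₀ = k / 2 := hp0
    have hp1 : #L₁ = k - k / 2 := hp1
    have hne : p (m - 1) ≠ p 0 := fun e => by
      have := hp.inj _ (by omega) _ (by omega) e
      omega
    have hdisj : Disjoint L₀ L₁ := by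
      rw [disjoint_left]
      intro v hv hv'
      rw [mem_filter] at hv hv'
      exact hne ((hleaf v hv.1 _ hv.2 _).1 hv'.2)
    have hun : L₀ ∪ L₁ = L := by
      refine eq_of_subset_of_card_le (union_subset (filter_subset _ _) (filter_subset _ _)) ?_
      rw [card_union_of_disjoint hdisj, hp0, hp1, hlv]
      omega
    refine BroomCoord.nonempty_iso (p := p) (L₀ := L₀) (L₁ := L₁)
      ⟨by omega, hdisj, by rwa [hun], ?_, ?_⟩ hp0 hp1
    · intro v hv
      rw [mem_filter] at hv
      exact hleaf v hv.1 _ hv.2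
    · intro v hv
      rw [mem_filter] at hv
      exact hleaf v hv.1 _ hv.2
  · -- the star: all leaves are attached to the same vertex
    have h1 : #(univ : Finset V) - k = 1 := by omega
    obtain ⟨c, hc⟩ := card_eq_one.1 (hC.trans h1)
    rw [hc, sum_singleton] at hsum
    have hall : {y ∈ L | G.Adj y c} = L := eq_of_subset_of_card_le (filter_subset _ _) hsum.ge
    obtain ⟨L₀, hsub, hcard⟩ := exists_subset_card_eq (s := L) (n := k / 2) (by omega)
    have hun : L₀ ∪ (L \ L₀) = L := union_sdiff_of_subset hsub
    have hadj : ∀ v ∈ L, ∀ x, G.Adj v x ↔ x = c := by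
      intro v hv
      rw [← hall, mem_filter] at hv
      exact hleaf v hv.1 _ hv.2
    rw [h1]
    refine BroomCoord.nonempty_iso (p := fun _ => c) (L₀ := L₀) (L₁ := L \ L₀)
      ⟨one_pos, disjoint_sdiff, ?_, fun v hv => hadj v (hsub hv),
        fun v hv => hadj v (mem_sdiff.1 hv).1⟩ hcard
      (by rw [card_sdiff_of_subset hsub, hlv, hcard])
    rw [hun, hc]
    exact ⟨by simp [eq_comm], by omega, by intro i hi j hj; simp; omega⟩

end

end

/-! ### The two extremal problems -/

variable {n k : ℕ}

lemma IsBalancedLegs.isTreeWithLeaves {l : Fin k → ℕ} (hk : 2 ≤ k) (hl : IsBalancedLegs n l) :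
    IsTreeWithLeaves n k (spider l) := by
  obtain ⟨f, hf⟩ := isSpiderOn_spider l
  rw [isTreeWithLeaves_iff]
  refine ⟨treeOn_univ.2 (spider_isTree l), ?_, hf.card_leavesIn hk hl.pos⟩
  rw [← hl.card_eq]
  simp [add_comm]

lemma IsBalancedLegs.numSubtrees_le {l : Fin k → ℕ} (hk : 2 ≤ k) (hl : IsBalancedLegs n l)
    {V : Type*} [Fintype V] {T : SimpleGraph V} (hT : IsTreeWithLeaves n k T) :
    numSubtrees T ≤ numSubtrees (spider l) ∧
      (numSubtrees T = numSubtrees (spider l) ↔ Nonempty (T ≃g spider l)) := by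
  obtain ⟨ht, hcard, hlv⟩ := isTreeWithLeaves_iff.1 hT
  have hl' : IsBalancedLegs #(univ : Finset V) l := by rwa [hcard]
  obtain ⟨h1, h2⟩ := ht.wcount_le hk hlv hl'
  rw [numSubtrees_eq_wcount T, numSubtrees_eq_wcount (spider l), (isSpiderOn_spider l).wcount.2]
  refine ⟨h1, fun heq => ?_, ?_⟩
  · rcases hk.eq_or_lt with rfl | hk
    · obtain ⟨b, v, m, hleg⟩ := ht.exists_leg_of_card_eq_two hlv
      have h3 := hleg.card_eq
      have h4 := hl'.card_eq
      rw [Fin.sum_univ_two, h3, card_singleton] at h4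
      obtain ⟨c, hc⟩ := hleg.isSpiderOn (m := l) (by omega)
      exact hc.nonempty_iso
    · obtain ⟨c, hc⟩ := h2 hk heq
      exact hc.nonempty_iso
  · rintro ⟨φ⟩
    rw [← numSubtrees_eq_wcount T, numSubtrees_congr φ, numSubtrees_eq_wcount,
      (isSpiderOn_spider l).wcount.2]

lemma isTreeWithLeaves_doubleBroom (hk : 2 ≤ k) (hkn : k ≤ n - 1) :
    IsTreeWithLeaves n k (doubleBroom (n - k) (k / 2) (k - k / 2)) ∧
      numSubtrees (doubleBroom (n - k) (k / 2) (k - k / 2)) =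
        (2 ^ (k / 2) + 2 ^ (k - k / 2)) * (n - k - 1) + 2 ^ k + k + (n - k - 1).choose 2 := by
  obtain ⟨p, L₀, L₁, h, h₀, h₁⟩ :=
    exists_broomCoord_doubleBroom (m := n - k) (a := k / 2) (b := k - k / 2) (by omega)
  have hne₀ : L₀.Nonempty := card_pos.1 (by omega)
  have hne₁ : L₁.Nonempty := card_pos.1 (by omega)
  have ht := treeOn_univ.2 (doubleBroom_isTree (m := n - k) (a := k / 2) (b := k - k / 2)
    (by omega))
  have hab : k / 2 + (k - k / 2) = k := by omega
  refine ⟨isTreeWithLeaves_iff.2 ⟨ht, ?_, ?_⟩, ?_⟩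
  · rw [h.card_univ, h₀, h₁]
    omega
  · rw [h.card_leavesIn hne₀ hne₁, h₀, h₁, hab]
  · rw [numSubtrees_eq_wcount, h.wcount_eq ht hne₀ hne₁, h₀, h₁, hab]

lemma IsTreeWithLeaves.numSubtrees_ge (hk : 2 ≤ k) (hkn : k ≤ n - 1) {V : Type*} [Fintype V]
    {T : SimpleGraph V} (hT : IsTreeWithLeaves n k T) :
    numSubtrees (doubleBroom (n - k) (k / 2) (k - k / 2)) ≤ numSubtrees T ∧
      (numSubtrees T = numSubtrees (doubleBroom (n - k) (k / 2) (k - k / 2)) ↔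
        Nonempty (T ≃g doubleBroom (n - k) (k / 2) (k - k / 2))) := by
  obtain ⟨ht, hcard, hlv⟩ := isTreeWithLeaves_iff.1 hT
  obtain ⟨h1, h2⟩ := ht.le_wcount_univ hk (by omega) hlv (by omega)
  rw [hcard] at h1 h2
  rw [(isTreeWithLeaves_doubleBroom hk hkn).2]
  refine ⟨by rwa [numSubtrees_eq_wcount], fun heq => h2 ?_, ?_⟩
  · rw [← heq, numSubtrees_eq_wcount]
  · rintro ⟨φ⟩
    rw [numSubtrees_congr φ, (isTreeWithLeaves_doubleBroom hk hkn).2]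

end Subtrees

theorem theorem1p1 (n k : ℕ) (_hn : 2 ≤ n) (hk : 2 ≤ k) (hkn : k ≤ n - 1) :
    -- (i) the spiders `T_n^k`
    ((∃ l : Fin k → ℕ, Subtrees.IsBalancedLegs n l) ∧
      ∀ l : Fin k → ℕ, Subtrees.IsBalancedLegs n l →
        Subtrees.IsTreeWithLeaves n k (Subtrees.spider l) ∧
        (∀ i j : ℕ, i + j = k → n - 1 ≡ j [MOD k] →
          Subtrees.numSubtrees (Subtrees.spider l) =
            ((n - 1) / k + 1) ^ i * ((n - 1) ⌈/⌉ k + 1) ^ j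
              + i * ((n - 1) / k + 1).choose 2 + j * ((n - 1) ⌈/⌉ k + 1).choose 2) ∧
        ∀ (V : Type*) [Fintype V] (T : SimpleGraph V), Subtrees.IsTreeWithLeaves n k T →
          Subtrees.numSubtrees T ≤ Subtrees.numSubtrees (Subtrees.spider l) ∧
          (Subtrees.numSubtrees T = Subtrees.numSubtrees (Subtrees.spider l) ↔
            Nonempty (T ≃g Subtrees.spider l))) ∧
    -- (ii) the graph `P_{n-k}(⌊k/2⌋, ⌈k/2⌉)`
    (Subtrees.IsTreeWithLeaves n k (Subtrees.doubleBroom (n - k) (k / 2) (k ⌈/⌉ 2)) ∧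
      Subtrees.numSubtrees (Subtrees.doubleBroom (n - k) (k / 2) (k ⌈/⌉ 2)) =
        (2 ^ (k / 2) + 2 ^ (k ⌈/⌉ 2)) * (n - k - 1) + 2 ^ k + k + (n - k - 1).choose 2 ∧
      ∀ (V : Type*) [Fintype V] (T : SimpleGraph V), Subtrees.IsTreeWithLeaves n k T →
        Subtrees.numSubtrees (Subtrees.doubleBroom (n - k) (k / 2) (k ⌈/⌉ 2)) ≤
          Subtrees.numSubtrees T ∧
        (Subtrees.numSubtrees T =
            Subtrees.numSubtrees (Subtrees.doubleBroom (n - k) (k / 2) (k ⌈/⌉ 2)) ↔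
          Nonempty (T ≃g Subtrees.doubleBroom (n - k) (k / 2) (k ⌈/⌉ 2)))) := by
  have hceil : k ⌈/⌉ 2 = k - k / 2 := by
    rw [Nat.ceilDiv_eq_add_pred_div]
    omega
  rw [hceil]
  refine ⟨⟨Subtrees.exists_isBalancedLegs (by omega) hkn, fun l hl =>
    ⟨hl.isTreeWithLeaves hk, fun i j hij hj => ?_, fun V _ T hT => hl.numSubtrees_le hk hT⟩⟩,
    (Subtrees.isTreeWithLeaves_doubleBroom hk hkn).1,
    (Subtrees.isTreeWithLeaves_doubleBroom hk hkn).2, fun V _ T hT => hT.numSubtrees_ge hk hkn⟩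
  rw [Subtrees.numSubtrees_eq_wcount, (Subtrees.isSpiderOn_spider l).wcount.2]
  exact hl.formula (by omega) hij hj
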